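/- Let $\mathbb K$ be $\mathbb R$ or $\mathbb C$, let $\alpha\ge 1$, $\xi\ge 0$ be integers, $M=2\alpha+\xi$, and let $U\subseteq\mathbb K$ be open and connected (non-empty). **Brackets.** An $(\alpha,\xi)$-bracket (with values of the canonical coordinate in $U$) is a Poisson bracket on sequences $u:\mathbb Z\to U$ of the form $\{u_n,u_{n+k}\}=g_k(u_n,\dots,u_{n+k})$ for $1\le k\le M$, $\{u_n,u_{n+k}\}=0$ for $k=0$ and $k>M$ (skew-symmetric, with the Jacobi identity), with $g_k$ analytic on $U^{k+1}$, such that $g_M(u_n,\dots,u_{n+M})=f(u_{n+\alpha},\dots,u_{n+\alpha+\xi})$ for a function $f=f(y_0,\dots,y_\xi)$ with $\partial_{y_0} f\cdot\partial_{y_\xi} f\not\equiv 0$ on $U^{\xi+1}$. For $\tau=(\tau_0,\dots,\tau_\xi)\in\mathbb K^{\xi+1}$ with $\tau_0\tau_\xi\ne 0$ put $\tau_s=0$ for $s>\xi$, let $\lambda^\alpha_{\alpha-r}$ for $0\le r<\alpha$ be the determinant of the $r\times r$ matrix with entries $a_{i-j+1}$, where $a_s=(-1)^s\tau_s/\tau_0$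 for $s\ge 0$ and $a_s=0$ for $s<0$; let $\lambda^\alpha_0=\tau_0/\tau_\xi$, and $\lambda^s_{s-r}=\lambda^\alpha_{\alpha-r}(\lambda^\alpha_0)^{-1}\lambda^\alpha_{\alpha-s}$ for $0\le s,r\le\alpha$. The bracket *has parameters $\tau$* if for all $p=-\alpha,\dots,\alpha$ with $\alpha+\xi+p\ge 1$ $$g_{\alpha+\xi+p}(u_n,\dots,u_{n+\alpha+\xi+p})=\sum_{s=\max(0,p)}^{\min(\alpha+p,\alpha)}\lambda^s_p\,\exp\Big(\sum_{i=0}^{\xi}\tau_i\,u_{n+s+i}\Big).$$ **Theorem.** Let an $(\alpha,\xi)$-bracket be given, and let $v_n^{1+p}=u_{nM+p}$, $p=0,\dots,M-1$, $\mathbf v_n=(v_n^1,\dots,v_n^M)\in U^M$. In the variables $\mathbf v_n$ the bracket is a first-order $M$-component Poisson bracket $$\{v_n^i,v_n^j\}=h^{ij}(\mathbf v_n),\qquad \{v_n^i,v_{n+1}^j\}=g^{ij}(\mathbf v_n,\mathbf v_{n+1}),\qquad \{v^i_n,v^j_m\}=0\ \ (|n-m|>1)$$ with $h,g$ analytic,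 and it is non-degenerate: $\det g(\mathbf v,\mathbf w)\ne 0$ for all $\mathbf v,\mathbf w\in U^M$. There are analytic matrix functions $L,R$ on $U^M$ and constants $c^r_{pq},\gamma^{pq}_r\in\mathbb K$ such that, with $L_s$ the $s$-th column of $L$ and $R^s$ the $s$-th row of $R$, regarded as vector fields on $U^M$ with the commutator $[X,Y]^k=X^s\partial_sY^k-Y^s\partial_sX^k$ (repeated indices are summed over $1,\dots,M$): 1. $g(\mathbf v,\mathbf w)=L(\mathbf v)\,R(\mathbf w)$ for all $\mathbf v,\mathbf w\in U^M$; 2. the $L_s$ are linearly independent and $[L_p,L_q]=c_{pq}^r L_r$; the $R^s$ are linearly independent and $[R^p,R^q]=\gamma^{pq}_r R^r$; 3. $(c,\gamma)$ are the structure constants of a Lie bialgebra: $c$ are the structure constants of a Lie algebra $\mathfrak g_{(\alpha,\xi)}=\mathrm{span}\{L_s\}$, $\gamma$ those of a Lie algebra $\mathfrak g^*_{(\alpha,\xi)}=\mathrm{span}\{R^s\}$, viewed as the dual of $\mathfrak g_{(\alpha,\xi)}$ through the dual bases $L_s$, $R^s$, and $c^\epsilon_{rs}\gamma^{pq}_\epsilon=c^p_{\epsilon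 s}\gamma^{\epsilon q}_r+c^q_{\epsilon s}\gamma^{p\epsilon}_r-c^p_{\epsilon r}\gamma^{\epsilon q}_s-c^q_{\epsilon r}\gamma^{p\epsilon}_s$; 4. this Lie bialgebra is associated with the bracket: $[L_p,R^q]=0$ for all $p,q$, and the Lie derivative of the bivector $h$ along $L_t$ is $\gamma^{pq}_t\,L_p\otimes L_q$ for all $t$. Moreover, the constants depend only on the parameters: for given $\alpha,\xi,\mathbb K$ there are functions $\tau\mapsto c(\tau)$ and $\tau\mapsto\gamma(\tau)$ such that, for every $U$ and every $(\alpha,\xi)$-bracket with parameters $\tau$, 1–4 hold with $c=c(\tau)$, $\gamma=\gamma(\tau)$ and $$L^i_s(\mathbf v)=\Lambda_{i-s}\exp\Big(\sum_{k=0}^{\xi}\tau_k v^{\alpha+s+k}\Big),\qquad R^{s j}(\mathbf w)=\exp\Big(\sum_{i=0}^{\xi}\tau_{\xi-i}\,w^{s-\alpha-i}\Big)\,\Lambda'_{s-j},$$ where $\Lambda_d=\lambda^{\alpha-d}_{\alpha-d}$ and $\Lambda'_d=\lambda^\alpha_{\alpha-d}$ for $0\le d\le\alpha$, $\Lambda_d=\Lambda'_d=0$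 otherwise, and $v^j=w^j=0$ for $j<1$ or $j>M$. -/

import Mathlib

namespace DiscretePB

section General

variable {𝕜 : Type*} [RCLike 𝕜]

/-- All families `x` of elements of `U` (the points whose coordinates lie in `U`). -/
def box {𝕜 : Type*} (ι : Type*) (U : Set 𝕜) : Set (ι → 𝕜) := {x | ∀ i, x i ∈ U}

/-- The partial derivative `∂F/∂x_s` at `x`. -/
noncomputable def partialDeriv {ι : Type*} [DecidableEq ι] (F : (ι → 𝕜) → 𝕜) (s : ι)
    (x : ι → 𝕜) : 𝕜 :=
  deriv (fun t => F (Function.update x s t)) (x s)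

/-- The bracket `{F, x_c} = ∑_s ∂F/∂x_s {x_s, x_c}` of a function with a coordinate, where
`P a b = {x_a, x_b}`. The sum has finitely many non-zero terms, as `F` will always depend on
finitely many of the coordinates. -/
noncomputable def bracketWithCoord {ι : Type*} [DecidableEq ι] (P : ι → ι → (ι → 𝕜) → 𝕜)
    (F : (ι → 𝕜) → 𝕜) (c : ι) (x : ι → 𝕜) : 𝕜 :=
  ∑ᶠ s, partialDeriv F s x * P s c x

/-- `{x_a, x_b} = P a b` defines a Poisson bracket on `Ω`: it is skew-symmetric and satisfies
the Jacobi identity `{{x_a,x_b},x_c} + {{x_b,x_c},x_a} + {{x_c,x_a},x_b} = 0`. -/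
structure IsPoisson {ι : Type*} [DecidableEq ι] (Ω : Set (ι → 𝕜))
    (P : ι → ι → (ι → 𝕜) → 𝕜) : Prop where
  skew : ∀ a b, ∀ x ∈ Ω, P a b x = -P b a x
  jacobi : ∀ a b c, ∀ x ∈ Ω,
    bracketWithCoord P (P a b) c x + bracketWithCoord P (P b c) a x
      + bracketWithCoord P (P c a) b x = 0

/-- The brackets of lattice variables `u_n`, `n ∈ ℤ`, of a scalar local bracket of order `M`:
`{u_n, u_{n+k}} = g_k(u_n, …, u_{n+k})` for `1 ≤ k ≤ M`, and `{u_n, u_{n+k}} = 0` for `k = 0`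
and `k > M`; the remaining ones by skew-symmetry. -/
def scalarBracket (M : ℕ) (g : (k : ℕ) → (Fin (k + 1) → 𝕜) → 𝕜) (n m : ℤ) (u : ℤ → 𝕜) : 𝕜 :=
  if n < m ∧ m ≤ n + M then g (m - n).toNat (fun i => u (n + (i : ℕ)))
  else if m < n ∧ n ≤ m + M then -g (n - m).toNat (fun i => u (m + (i : ℕ)))
  else 0

/-- The brackets of the variables `v_n^i`, `n ∈ ℤ`, `i = 1, …, N`, of an `N`-component local
bracket of first order: `{v_n^i, v_n^j} = h^{ij}(v_n)`,
`{v_n^i, v_{n+1}^j} = g^{ij}(v_n, v_{n+1})`, and `{v_n^i, v_m^j} = 0` for `|n - m| > 1`. -/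
def firstOrderBracket {N : ℕ} (h : (Fin N → 𝕜) → Matrix (Fin N) (Fin N) 𝕜)
    (g : (Fin N → 𝕜) → (Fin N → 𝕜) → Matrix (Fin N) (Fin N) 𝕜)
    (a b : ℤ × Fin N) (v : ℤ × Fin N → 𝕜) : 𝕜 :=
  if a.1 = b.1 then h (fun s => v (a.1, s)) a.2 b.2
  else if b.1 = a.1 + 1 then g (fun s => v (a.1, s)) (fun s => v (b.1, s)) a.2 b.2
  else if a.1 = b.1 + 1 then -g (fun s => v (b.1, s)) (fun s => v (a.1, s)) b.2 a.2
  else 0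

/-- An `(α, ξ)`-bracket whose canonical coordinate takes its values in `U`: a scalar local Poisson
bracket of order `M = 2α + ξ` with analytic coefficients, whose leading coefficient is
`g_M(u_n, …, u_{n+M}) = f(u_{n+α}, …, u_{n+α+ξ})` with
`∂f/∂u_{n+α} · ∂f/∂u_{n+α+ξ}` not identically zero (in particular `f` is not constant). -/
structure IsAlphaXiBracket (α ξ : ℕ) (U : Set 𝕜) (g : (k : ℕ) → (Fin (k + 1) → 𝕜) → 𝕜) :
    Prop where
  analytic : ∀ k, 1 ≤ k → k ≤ 2 * α + ξ → AnalyticOnNhd 𝕜 (g k) (box (Fin (k + 1)) U)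
  poisson : IsPoisson (box ℤ U) (scalarBracket (2 * α + ξ) g)
  leading : ∃ f : (Fin (ξ + 1) → 𝕜) → 𝕜,
    (∀ x ∈ box (Fin (2 * α + ξ + 1)) U,
      g (2 * α + ξ) x = f (fun i => x ⟨α + i, by omega⟩)) ∧
    ∃ y ∈ box (Fin (ξ + 1)) U, partialDeriv f 0 y * partialDeriv f (Fin.last ξ) y ≠ 0

/-- The consolidation of the lattice: `v_n^{1+p} = u_{nM+p}`, `p = 0, …, M - 1`. -/
def consolidate (M : ℕ) (u : ℤ → 𝕜) : ℤ × Fin M → 𝕜 := fun a => u (a.1 * M + (a.2 : ℕ))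

end General

section Parameters

variable {𝕜 : Type*} [RCLike 𝕜]

/-- The band Toeplitz matrix of size `r` with `a_1` on the diagonal, `a_0` just above it,
`a_2, a_3, …` on the diagonals below it, and `0` elsewhere. -/
def bandToeplitz (r : ℕ) (a : ℕ → 𝕜) : Matrix (Fin r) (Fin r) 𝕜 :=
  fun i j => if (j : ℕ) ≤ i + 1 then a (i + 1 - j) else 0

/-- `τ_s`, with the convention `τ_s = 0` for `s > ξ`. -/
def tauExt {ξ : ℕ} (τ : Fin (ξ + 1) → 𝕜) (s : ℕ) : 𝕜 := if h : s < ξ + 1 then τ ⟨s, h⟩ else 0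

/-- The scalars `λ^α_{α-r}`, `r = 0, …, α`. -/
noncomputable def lamEdge (α : ℕ) {ξ : ℕ} (τ : Fin (ξ + 1) → 𝕜) (r : ℕ) : 𝕜 :=
  if r < α then (bandToeplitz r (fun s => (-1) ^ s * (τ 0)⁻¹ * tauExt τ s)).det
  else τ 0 * (τ (Fin.last ξ))⁻¹

/-- The scalars `λ^s_{s-r} = λ^α_{α-r} (λ^α_0)⁻¹ λ^α_{α-s}`, `s, r = 0, …, α`. -/
noncomputable def lam (α : ℕ) {ξ : ℕ} (τ : Fin (ξ + 1) → 𝕜) (s r : ℕ) : 𝕜 :=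
  lamEdge α τ r * (lamEdge α τ α)⁻¹ * lamEdge α τ s

/-- The bracket with coefficients `g` has parameters `τ`: for `p = k - α - ξ` and `1 ≤ k ≤ 2α + ξ`,
`g_k(x_0, …, x_k) = ∑_s λ^s_p exp (∑_i τ_i x_{s+i})`, over all `s` such that `s` and `r = s - p`
lie in `{0, …, α}`, that is, from `max(0, p)` to `min(α + p, α)`. -/
def HasParameters (α : ℕ) {ξ : ℕ} (τ : Fin (ξ + 1) → 𝕜) (U : Set 𝕜)
    (g : (k : ℕ) → (Fin (k + 1) → 𝕜) → 𝕜) : Prop :=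
  ∀ k, 1 ≤ k → k ≤ 2 * α + ξ → ∀ x ∈ box (Fin (k + 1)) U,
    g k x = ∑ s : Fin (α + 1), ∑ r : Fin (α + 1),
      if h : α + ξ + (s : ℕ) = k + r then
        lam α τ s r *
          NormedSpace.exp (∑ i : Fin (ξ + 1), τ i * x ⟨(s : ℕ) + i, by omega⟩)
      else 0

/-- The matrix `L(v) = Λ_L diag(l_1, …, l_M)`, where `l_s = exp (∑_i τ_i v^{α+s+i})` with
`v^j = 0` for `j > M`, and `Λ_L` is the lower triangular band matrix with the entry
`λ^{α-d}_{α-d}` in column `s` and row `s + d`, `0 ≤ d ≤ α` (indices start from `0` in the code). -/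
noncomputable def matL (α : ℕ) {ξ : ℕ} (τ : Fin (ξ + 1) → 𝕜) (v : Fin (2 * α + ξ) → 𝕜) :
    Matrix (Fin (2 * α + ξ)) (Fin (2 * α + ξ)) 𝕜 :=
  fun i s =>
    (if (s : ℕ) ≤ i ∧ (i : ℕ) ≤ s + α then lam α τ (α - (i - s)) 0 else 0) *
      NormedSpace.exp (∑ k : Fin (ξ + 1),
        if h : α + (s : ℕ) + k < 2 * α + ξ then τ k * v ⟨α + s + k, h⟩ else 0)

/-- The matrix `R(w) = diag(r_1, …, r_M) Λ_R`, where `r_s = exp (∑_i τ_{ξ-i} w^{s-α-i})` with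
`w^j = 0` for `j < 1`, and `Λ_R` is the lower triangular band matrix with the entry
`λ^α_{α-d}` in row `s` and column `s - d`, `0 ≤ d ≤ α` (indices start from `0` in the code, and
`k = ξ - i`). -/
noncomputable def matR (α : ℕ) {ξ : ℕ} (τ : Fin (ξ + 1) → 𝕜) (w : Fin (2 * α + ξ) → 𝕜) :
    Matrix (Fin (2 * α + ξ)) (Fin (2 * α + ξ)) 𝕜 :=
  fun s j =>
    NormedSpace.exp (∑ k : Fin (ξ + 1),
        if h : α + ξ ≤ (s : ℕ) + k then
          τ k * w ⟨(s : ℕ) + k - (α + ξ), by have := s.2; have := k.2; omega⟩ else 0) *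
      (if (j : ℕ) ≤ s ∧ (s : ℕ) ≤ j + α then lamEdge α τ (s - j) else 0)

end Parameters

section LieBialgebra

variable {𝕜 : Type*} [RCLike 𝕜] {N : ℕ}

/-- `c p q r = c_{pq}^r` are the structure constants of a Lie algebra of dimension `N`:
`[e_p, e_q] = ∑_r c_{pq}^r e_r` is skew-symmetric and satisfies the Jacobi identity. -/
structure IsLieConstants (c : Fin N → Fin N → Fin N → 𝕜) : Prop where
  skew : ∀ p q r, c p q r = -c q p r
  jacobi : ∀ p q r s,
    ∑ e, (c p q e * c e r s + c q r e * c e p s + c r p e * c e q s) = 0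

/-- `c p q r = c_{pq}^r` and `γ p q r = γ^{pq}_r` are the structure constants of a Lie bialgebra:
`c` defines a Lie algebra `𝔤`, `γ` defines a Lie algebra structure on its dual, and
`e_r ↦ ∑ γ^{pq}_r e_p ⊗ e_q` is a 1-cocycle of `𝔤` with values in `𝔤 ⊗ 𝔤`. -/
structure IsLieBialgebra (c γ : Fin N → Fin N → Fin N → 𝕜) : Prop where
  lie : IsLieConstants c
  dual : IsLieConstants γ
  cocycle : ∀ r s p q,
    ∑ e, c r s e * γ p q e =
      ∑ e, (c e s p * γ e q r + c e s q * γ p e r - c e r p * γ e q s - c e r q * γ p e s)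

/-- The vector fields `X_1, …, X_N` are a basis of a Lie algebra of vector fields on `W`, with
structure constants `c`. -/
structure IsLieBasis (W : Set (Fin N → 𝕜)) (X : Fin N → (Fin N → 𝕜) → (Fin N → 𝕜))
    (c : Fin N → Fin N → Fin N → 𝕜) : Prop where
  indep : LinearIndependent 𝕜 (fun s => W.domRestrict (X s))
  bracket : ∀ p q, ∀ v ∈ W,
    VectorField.lieBracket 𝕜 (X p) (X q) v = ∑ r, c p q r • X r v

/-- The bracket `{v_n^i, v_n^j} = h^{ij}(v_n)`, `{v_n^i, v_{n+1}^j} = g^{ij}(v_n, v_{n+1})` factorizes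
through `L` and `R`, with associated Lie bialgebra `(c, γ)`. -/
structure HasLieBialgebra (W : Set (Fin N → 𝕜))
    (h : (Fin N → 𝕜) → Matrix (Fin N) (Fin N) 𝕜)
    (g : (Fin N → 𝕜) → (Fin N → 𝕜) → Matrix (Fin N) (Fin N) 𝕜)
    (L R : (Fin N → 𝕜) → Matrix (Fin N) (Fin N) 𝕜)
    (c γ : Fin N → Fin N → Fin N → 𝕜) : Prop where
  analytic_L : ∀ i j, AnalyticOnNhd 𝕜 (fun v => L v i j) W
  analytic_R : ∀ i j, AnalyticOnNhd 𝕜 (fun v => R v i j) W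
  /-- the leading matrix is `L(v_n) R(v_{n+1})` -/
  factor : ∀ v ∈ W, ∀ w ∈ W, g v w = L v * R w
  /-- the columns of `L` span a Lie algebra with structure constants `c` -/
  columns : IsLieBasis W (fun s v i => L v i s) c
  /-- the rows of `R` span a Lie algebra with structure constants `γ` -/
  rows : IsLieBasis W (fun s v j => R v s j) γ
  /-- `(c, γ)` is a Lie bialgebra -/
  bialgebra : IsLieBialgebra c γ
  /-- the columns of `L` commute with the rows of `R` (like left- and right-invariant fields) -/
  commute : ∀ p q, ∀ v ∈ W,
    VectorField.lieBracket 𝕜 (fun v i => L v i p) (fun v j => R v q j) v = 0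
  /-- `γ` is the cocycle of the bivector `h`: the Lie derivative of `h` along the column `L_t` is
  `∑ γ^{pq}_t L_p ⊗ L_q` -/
  associated : ∀ t i j, ∀ v ∈ W,
    ∑ s, (partialDeriv (fun v => h v i j) s v * L v s t
        - h v i s * partialDeriv (fun v => L v j t) s v
        - h v s j * partialDeriv (fun v => L v i t) s v) =
      ∑ p, ∑ q, γ p q t * L v i p * L v j q

end LieBialgebra

end DiscretePB

namespace DiscretePB

variable {𝕜 : Type*} [RCLike 𝕜] {N : ℕ}

open VectorField Matrix

/-! ### Derivatives in coordinates -/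

/-! Regrouping `M` consecutive sites into one cell is a reindexing of the coordinates, so the
Poisson axioms survive. The block `g` is lower triangular, since the sites `i` and `M + j` are more
than `M` apart when `j > i`, and its diagonal carries the leading coefficient `g_M`. Non-degeneracy
therefore means that `g_M` has no zeros. This is the analytic heart (`hasLogDeriv_of_poisson`,
`IsAlphaXiBracket.leading_ne_zero`): the Jacobi identity for three well-chosen sites gives `∂_i f =
B f` with analytic `B`, first for the outermost arguments of `f` and then inwards from both ends. A
solution of such an equation that vanishes at one point of `U` vanishes on all of it, and `f` is not
identically zero.

Once `g` is invertible, the Jacobi identity for the cells `n, n+1, n+2` says that the rows of `g` in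
its second argument commute, as vector fields, with the columns of `g` in its first argument. A
field that commutes with a frame `Y` is a combination with constant coefficients of any other frame
commuting with `Y` (`exists_const_combination`). Hence the rows of `g(v, ·)` are constant
combinations of those of `g(v₀, ·)`, which is the factorization `g = L R`. The fields `L_p` and
`R^q` commute; by the Jacobi identity `[L_p, L_q]` then commutes with every `R^s`, so it is a
constant combination of the `L_r`, and symmetrically for `R`. The Jacobi identity for the cells `n,
n, n+1` gives the Lie derivative of `h`, and the cocycle condition follows on applying two such
derivatives in both orders (`cocycle_of_associated`).

For a bracket with parameters `τ`, the matrices `matL` and `matR` are an explicit factorization of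
`g`. Their entries are analytic on the whole space, so the structure constants are determined by `τ`
alone, independently of `U` and of the bracket (`structureConstants_eq`). -/

lemma partialDeriv_eq_fderiv {ι : Type*} [Fintype ι] [DecidableEq ι] {F : (ι → 𝕜) → 𝕜}
    {x : ι → 𝕜} (hF : DifferentiableAt 𝕜 F x) (s : ι) :
    partialDeriv F s x = fderiv 𝕜 F x (Pi.single s 1) := by
  have h1 : HasFDerivAt F (fderiv 𝕜 F x) (Function.update x s (x s)) := by
    rw [Function.update_eq_self]; exact hF.hasFDerivAt
  exact (h1.comp_hasDerivAt (x s) (hasDerivAt_update x s (x s))).deriv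

lemma sum_partialDeriv_mul {ι : Type*} [Fintype ι] [DecidableEq ι] {F : (ι → 𝕜) → 𝕜}
    {x : ι → 𝕜} (hF : DifferentiableAt 𝕜 F x) (X : ι → 𝕜) :
    ∑ s, partialDeriv F s x * X s = fderiv 𝕜 F x X := by
  conv_rhs => rw [pi_eq_sum_univ' X]
  simp [map_sum, partialDeriv_eq_fderiv hF, mul_comm]

lemma lieBracket_coord {X Y : (Fin N → 𝕜) → (Fin N → 𝕜)} {v : Fin N → 𝕜}
    (hX : DifferentiableAt 𝕜 X v) (hY : DifferentiableAt 𝕜 Y v) (i : Fin N) :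
    lieBracket 𝕜 X Y v i =
      fderiv 𝕜 (fun v => Y v i) v (X v) - fderiv 𝕜 (fun v => X v i) v (Y v) := by
  rw [fderiv_apply hX, fderiv_apply hY]
  simp [lieBracket_eq]

lemma lieBracket_sum_smul_right {ι : Type*} (s : Finset ι) {V : (Fin N → 𝕜) → (Fin N → 𝕜)}
    {a : ι → (Fin N → 𝕜) → 𝕜} {X : ι → (Fin N → 𝕜) → (Fin N → 𝕜)} {v : Fin N → 𝕜}
    (ha : ∀ p ∈ s, DifferentiableAt 𝕜 (a p) v) (hX : ∀ p ∈ s, DifferentiableAt 𝕜 (X p) v) :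
    lieBracket 𝕜 V (fun x => ∑ p ∈ s, a p x • X p x) v =
      ∑ p ∈ s, (fderiv 𝕜 (a p) v (V v) • X p v + a p v • lieBracket 𝕜 V (X p) v) := by
  simp only [lieBracket_eq]
  rw [fderiv_fun_sum (fun p hp => (ha p hp).fun_smul (hX p hp)), _root_.sum_apply,
    map_sum, ← Finset.sum_sub_distrib]
  refine Finset.sum_congr rfl fun p hp => ?_
  rw [fderiv_fun_smul (ha p hp) (hX p hp)]
  simp [smul_sub]
  abel

lemma lieBracket_sum_const_smul_right {ι : Type*} (s : Finset ι)
    {V : (Fin N → 𝕜) → (Fin N → 𝕜)}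
    {a : ι → 𝕜} {X : ι → (Fin N → 𝕜) → (Fin N → 𝕜)} {v : Fin N → 𝕜}
    (hX : ∀ p ∈ s, DifferentiableAt 𝕜 (X p) v) :
    lieBracket 𝕜 V (fun x => ∑ p ∈ s, a p • X p x) v =
      ∑ p ∈ s, a p • lieBracket 𝕜 V (X p) v := by
  rw [lieBracket_sum_smul_right s (a := fun p _ => a p) (fun p _ => differentiableAt_const _) hX]
  simp

/-! ### Analytic frames -/

lemma analyticAt_det {E : Type*} [NormedAddCommGroup E] [NormedSpace 𝕜 E]
    {A : E → Matrix (Fin N) (Fin N) 𝕜} {v : E}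
    (hA : ∀ i j, AnalyticAt 𝕜 (fun v => A v i j) v) : AnalyticAt 𝕜 (fun v => (A v).det) v := by
  simp only [det_apply']
  exact Finset.analyticAt_fun_sum _ fun σ _ =>
    analyticAt_const.mul (Finset.analyticAt_fun_prod _ fun i _ => hA _ _)

lemma analyticAt_inv_apply {E : Type*} [NormedAddCommGroup E] [NormedSpace 𝕜 E]
    {A : E → Matrix (Fin N) (Fin N) 𝕜} {v : E}
    (hA : ∀ i j, AnalyticAt 𝕜 (fun v => A v i j) v) (hdet : (A v).det ≠ 0) (i j : Fin N) :
    AnalyticAt 𝕜 (fun v => (A v)⁻¹ i j) v := by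
  simp only [Matrix.inv_def, Ring.inverse_eq_inv', Matrix.smul_apply, adjugate_apply, smul_eq_mul]
  refine ((analyticAt_det hA).inv hdet).mul (analyticAt_det fun k l => ?_)
  simp only [updateRow_apply]
  split_ifs
  · exact analyticAt_const
  · exact hA k l

lemma analyticAt_matrix_mul {E : Type*} [NormedAddCommGroup E] [NormedSpace 𝕜 E]
    {A B : E → Matrix (Fin N) (Fin N) 𝕜} {v : E}
    (hA : ∀ i j, AnalyticAt 𝕜 (fun v => A v i j) v)
    (hB : ∀ i j, AnalyticAt 𝕜 (fun v => B v i j) v) (i j : Fin N) :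
    AnalyticAt 𝕜 (fun v => (A v * B v) i j) v := by
  simp only [mul_apply]
  exact Finset.analyticAt_fun_sum _ fun k _ => (hA i k).mul (hB k j)

/-- The matrix whose columns are the vectors `X p v`. -/
def frameMatrix (X : Fin N → (Fin N → 𝕜) → (Fin N → 𝕜)) (v : Fin N → 𝕜) :
    Matrix (Fin N) (Fin N) 𝕜 := Matrix.of fun i p => X p v i

lemma linearIndependent_of_frameMatrix {X : Fin N → (Fin N → 𝕜) → (Fin N → 𝕜)} {v : Fin N → 𝕜}
    (h : (frameMatrix X v).det ≠ 0) : LinearIndependent 𝕜 (fun p => X p v) := by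
  have := Matrix.linearIndependent_cols_of_det_ne_zero h
  exact this

lemma frameMatrix_mulVec (X : Fin N → (Fin N → 𝕜) → (Fin N → 𝕜)) (v : Fin N → 𝕜)
    (a : Fin N → 𝕜) : frameMatrix X v *ᵥ a = ∑ p, a p • X p v := by
  ext i
  simp [frameMatrix, mulVec, dotProduct, mul_comm]

/-- A vector field which commutes with a frame is a combination with constant coefficients of
any other frame that commutes with it. -/
theorem exists_const_combination {W : Set (Fin N → 𝕜)} (hW : IsOpen W) (hWc : IsConnected W)
    {X Y : Fin N → (Fin N → 𝕜) → (Fin N → 𝕜)} {Z : (Fin N → 𝕜) → (Fin N → 𝕜)}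
    (hX : ∀ p, AnalyticOnNhd 𝕜 (X p) W) (hZ : AnalyticOnNhd 𝕜 Z W)
    (hXdet : ∀ v ∈ W, (frameMatrix X v).det ≠ 0) (hYdet : ∀ v ∈ W, (frameMatrix Y v).det ≠ 0)
    (hXY : ∀ p q, ∀ v ∈ W, lieBracket 𝕜 (Y q) (X p) v = 0)
    (hZY : ∀ q, ∀ v ∈ W, lieBracket 𝕜 (Y q) Z v = 0) :
    ∃ a : Fin N → 𝕜, ∀ v ∈ W, Z v = ∑ p, a p • X p v := by
  have hXc : ∀ v ∈ W, ∀ i j, AnalyticAt 𝕜 (fun v => frameMatrix X v i j) v := fun v hv i j =>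
    analyticAt_pi_iff.1 (hX j v hv) i
  obtain ⟨a, haA, hZeq⟩ : ∃ a : Fin N → (Fin N → 𝕜) → 𝕜, (∀ p, AnalyticOnNhd 𝕜 (a p) W) ∧
      ∀ v ∈ W, Z v = ∑ p, a p v • X p v := by
    refine ⟨fun p v => ((frameMatrix X v)⁻¹ *ᵥ Z v) p, fun p v hv => ?_, fun v hv => ?_⟩
    · simp only [mulVec, dotProduct]
      exact Finset.analyticAt_fun_sum _ fun k _ =>
        (analyticAt_inv_apply (hXc v hv) (hXdet v hv) p k).mul (analyticAt_pi_iff.1 (hZ v hv) k)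
    · rw [← frameMatrix_mulVec X v ((frameMatrix X v)⁻¹ *ᵥ Z v),
        mulVec_mulVec, Matrix.mul_nonsing_inv _ (isUnit_iff_ne_zero.2 (hXdet v hv)), one_mulVec]
  -- Because `[Y_q, X_p] = 0`, bracketing `Z = ∑ a_p X_p` with `Y_q` leaves `∑ Y_q(a_p) X_p = 0`.
  -- The `X_p` are independent and the `Y_q` span, so every `d a_p` vanishes.
  have hder : ∀ p, ∀ v ∈ W, fderiv 𝕜 (a p) v = 0 := by
    intro p v hv
    have hq : ∀ q, fderiv 𝕜 (a p) v (Y q v) = 0 := by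
      intro q
      have h1 : lieBracket 𝕜 (Y q) Z v = lieBracket 𝕜 (Y q) (fun x => ∑ p, a p x • X p x) v :=
        Filter.EventuallyEq.lieBracket_vectorField_eq Filter.EventuallyEq.rfl
          (Filter.eventually_of_mem (hW.mem_nhds hv) hZeq)
      rw [hZY q v hv, lieBracket_sum_smul_right _ (fun p _ => (haA p v hv).differentiableAt)
        (fun p _ => (hX p v hv).differentiableAt)] at h1
      simp only [hXY _ q v hv, smul_zero, add_zero] at h1
      have hli := linearIndependent_of_frameMatrix (hXdet v hv)
      exact Fintype.linearIndependent_iff.1 hli (fun p => fderiv 𝕜 (a p) v (Y q v)) h1.symm p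
    ext x
    have hx : x = ∑ q, ((frameMatrix Y v)⁻¹ *ᵥ x) q • Y q v := by
      rw [← frameMatrix_mulVec, mulVec_mulVec,
        Matrix.mul_nonsing_inv _ (isUnit_iff_ne_zero.2 (hYdet v hv)), one_mulVec]
    rw [hx]
    simp [hq]
  have hconst : ∀ p, ∃ c, ∀ v ∈ W, a p v = c := fun p =>
    hW.exists_is_const_of_fderiv_eq_zero hWc.isPreconnected (haA p).differentiableOn
      (fun v hv => hder p v hv)
  choose c hc using hconst
  exact ⟨c, fun v hv => by rw [hZeq v hv]; exact Finset.sum_congr rfl fun p _ => by rw [hc p v hv]⟩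

/-- The structure constants of a frame closed under commutators define a Lie algebra. -/
theorem isLieConstants_of_frame {W : Set (Fin N → 𝕜)} (hW : IsOpen W) (hne : W.Nonempty)
    {X : Fin N → (Fin N → 𝕜) → (Fin N → 𝕜)} (hX : ∀ p, AnalyticOnNhd 𝕜 (X p) W)
    (hXdet : ∀ v ∈ W, (frameMatrix X v).det ≠ 0) {c : Fin N → Fin N → Fin N → 𝕜}
    (hc : ∀ p q, ∀ v ∈ W, lieBracket 𝕜 (X p) (X q) v = ∑ r, c p q r • X r v) :
    IsLieConstants c := by
  obtain ⟨v, hv⟩ := hne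
  have hli := linearIndependent_of_frameMatrix (hXdet v hv)
  have hskew : ∀ p q r, c p q r = -c q p r := by
    intro p q r
    have h1 : ∑ r, (c p q r + c q p r) • X r v = 0 := by
      simp only [add_smul, Finset.sum_add_distrib, ← hc _ _ v hv]
      rw [lieBracket_swap]; simp
    exact eq_neg_of_add_eq_zero_left (Fintype.linearIndependent_iff.1 hli _ h1 r)
  have hXd : ∀ p, DifferentiableAt 𝕜 (X p) v := fun p => (hX p v hv).differentiableAt
  have hnest : ∀ p q r, lieBracket 𝕜 (X p) (lieBracket 𝕜 (X q) (X r)) v =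
      ∑ s, (∑ e, c q r e * c p e s) • X s v := by
    intro p q r
    rw [Filter.EventuallyEq.lieBracket_vectorField_eq Filter.EventuallyEq.rfl
      (Filter.eventually_of_mem (hW.mem_nhds hv) (hc q r)),
      lieBracket_sum_const_smul_right _ fun p _ => hXd p]
    simp only [hc _ _ v hv, Finset.smul_sum, Finset.sum_smul, smul_smul]
    rw [Finset.sum_comm]
  refine ⟨hskew, fun p q r s => ?_⟩
  have hcd : ∀ p, ContDiffAt 𝕜 (minSmoothness 𝕜 2) (X p) v := fun p => (hX p v hv).contDiffAt
  have hJ := leibniz_identity_lieBracket le_rfl (hcd p) (hcd q) (hcd r)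
  rw [lieBracket_swap (V := lieBracket 𝕜 (X p) (X q)), hnest, hnest, hnest] at hJ
  have h1 : ∑ s, ((∑ e, c q r e * c p e s) + (∑ e, c p q e * c r e s)
      - ∑ e, c p r e * c q e s) • X s v = 0 := by
    simp only [add_smul, sub_smul, Finset.sum_add_distrib, Finset.sum_sub_distrib]
    rw [hJ]; abel
  have h2 := Fintype.linearIndependent_iff.1 hli _ h1 s
  rw [← neg_eq_zero, ← h2, ← Finset.sum_add_distrib, ← Finset.sum_sub_distrib,
    ← Finset.sum_neg_distrib]
  refine Finset.sum_congr rfl fun e _ => ?_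
  rw [hskew e r s, hskew e p s, hskew e q s, hskew r p e]
  ring

end DiscretePB

namespace DiscretePB

variable {𝕜 : Type*} [RCLike 𝕜] {N : ℕ}

open VectorField Matrix

/-! ### The derivative of a matrix function -/

/-- The entrywise derivative of a matrix function along a vector. -/
noncomputable def matDeriv {m n : Type*} (A : (Fin N → 𝕜) → Matrix m n 𝕜) (v x : Fin N → 𝕜) :
    Matrix m n 𝕜 := Matrix.of fun i j => fderiv 𝕜 (fun v => A v i j) v x

lemma matDeriv_mul {l m n : Type*} [Fintype m] {A : (Fin N → 𝕜) → Matrix l m 𝕜}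
    {B : (Fin N → 𝕜) → Matrix m n 𝕜} {v : Fin N → 𝕜}
    (hA : ∀ i j, DifferentiableAt 𝕜 (fun v => A v i j) v)
    (hB : ∀ i j, DifferentiableAt 𝕜 (fun v => B v i j) v) (x : Fin N → 𝕜) :
    matDeriv (fun v => A v * B v) v x = matDeriv A v x * B v + A v * matDeriv B v x := by
  ext i j
  simp only [matDeriv, mul_apply, of_apply, Matrix.add_apply]
  rw [fderiv_fun_sum (fun k _ => (hA i k).fun_mul (hB k j)), _root_.sum_apply,
    ← Finset.sum_add_distrib]
  refine Finset.sum_congr rfl fun k _ => ?_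
  rw [fderiv_fun_mul (hA i k) (hB k j)]
  simp only [_root_.add_apply, _root_.smul_apply, smul_eq_mul]
  ring

lemma matDeriv_transpose {m n : Type*} (A : (Fin N → 𝕜) → Matrix m n 𝕜) (v x : Fin N → 𝕜) :
    matDeriv (fun v => (A v)ᵀ) v x = (matDeriv A v x)ᵀ := rfl

lemma matDeriv_const {m n : Type*} (A : Matrix m n 𝕜) (v x : Fin N → 𝕜) :
    matDeriv (fun _ => A) v x = 0 := by
  ext i j; simp [matDeriv]

lemma matDeriv_sub {m n : Type*} {A B : (Fin N → 𝕜) → Matrix m n 𝕜} {v : Fin N → 𝕜}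
    (hA : ∀ i j, DifferentiableAt 𝕜 (fun v => A v i j) v)
    (hB : ∀ i j, DifferentiableAt 𝕜 (fun v => B v i j) v) (x : Fin N → 𝕜) :
    matDeriv (fun v => A v - B v) v x = matDeriv A v x - matDeriv B v x := by
  ext i j
  simp only [matDeriv, Matrix.sub_apply, of_apply]
  rw [fderiv_fun_sub (hA i j) (hB i j)]
  simp

lemma matDeriv_congr {m n : Type*} {A B : (Fin N → 𝕜) → Matrix m n 𝕜} {v : Fin N → 𝕜}
    (h : A =ᶠ[nhds v] B) (x : Fin N → 𝕜) : matDeriv A v x = matDeriv B v x := by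
  ext i j
  simp only [matDeriv, of_apply]
  have h1 : (fun v => A v i j) =ᶠ[nhds v] fun v => B v i j := h.mono fun v hv => by simp only [hv]
  rw [h1.fderiv_eq]

lemma differentiableAt_mul_apply {l m n : Type*} [Fintype m] {A : (Fin N → 𝕜) → Matrix l m 𝕜}
    {B : (Fin N → 𝕜) → Matrix m n 𝕜} {v : Fin N → 𝕜}
    (hA : ∀ i j, DifferentiableAt 𝕜 (fun v => A v i j) v)
    (hB : ∀ i j, DifferentiableAt 𝕜 (fun v => B v i j) v) (i : l) (j : n) :
    DifferentiableAt 𝕜 (fun v => (A v * B v) i j) v := by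
  simp only [mul_apply]
  exact DifferentiableAt.fun_sum fun k _ => (hA i k).fun_mul (hB k j)

/-! ### The cocycle condition -/

/-- The matrix of `ad e_t` in the Lie algebra with structure constants `c`. -/
def adMatrix (c : Fin N → Fin N → Fin N → 𝕜) (t : Fin N) : Matrix (Fin N) (Fin N) 𝕜 :=
  Matrix.of fun e p => c t p e

/-- The components of the cobracket of `e_t`. -/
def cobracketMatrix (γ : Fin N → Fin N → Fin N → 𝕜) (t : Fin N) : Matrix (Fin N) (Fin N) 𝕜 :=
  Matrix.of fun p q => γ p q t

/-- The Jacobi identity, read as the statement that `ad` is a representation. -/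
lemma adMatrix_commutator {c : Fin N → Fin N → Fin N → 𝕜} (hc : IsLieConstants c) (r s : Fin N) :
    adMatrix c r * adMatrix c s - adMatrix c s * adMatrix c r = ∑ e, c r s e • adMatrix c e := by
  ext a p
  have h := hc.jacobi r s p a
  simp only [adMatrix, Matrix.sub_apply, mul_apply, of_apply, Matrix.sum_apply,
    Matrix.smul_apply, smul_eq_mul]
  rw [← sub_eq_zero, ← neg_eq_zero, ← h, ← Finset.sum_sub_distrib, ← Finset.sum_sub_distrib,
    ← Finset.sum_neg_distrib]
  refine Finset.sum_congr rfl fun e _ => ?_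
  rw [hc.skew e r a, hc.skew e s a, hc.skew p r e]
  ring

/-- If the Lie derivatives of a bivector along a frame `L` of a Lie algebra of vector fields have
constant components `γ` in this frame, then `γ` is a cocycle. -/
theorem cocycle_of_associated {W : Set (Fin N → 𝕜)} (hW : IsOpen W) (hne : W.Nonempty)
    {h L : (Fin N → 𝕜) → Matrix (Fin N) (Fin N) 𝕜} {c γ : Fin N → Fin N → Fin N → 𝕜}
    (hh : ∀ i j, AnalyticOnNhd 𝕜 (fun v => h v i j) W)
    (hL : ∀ i j, AnalyticOnNhd 𝕜 (fun v => L v i j) W)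
    (hdet : ∀ v ∈ W, (L v).det ≠ 0) (hc : IsLieConstants c)
    (hcol : ∀ p q, ∀ v ∈ W,
      lieBracket 𝕜 (fun v i => L v i p) (fun v i => L v i q) v = ∑ r, c p q r • fun i => L v i r)
    (hass : ∀ t i j, ∀ v ∈ W,
      ∑ s, (partialDeriv (fun v => h v i j) s v * L v s t
        - h v i s * partialDeriv (fun v => L v j t) s v
        - h v s j * partialDeriv (fun v => L v i t) s v) =
      ∑ p, ∑ q, γ p q t * L v i p * L v j q) (r s p q : Fin N) :
    ∑ e, c r s e * γ p q e =
      ∑ e, (c e s p * γ e q r + c e s q * γ p e r - c e r p * γ e q s - c e r q * γ p e s) := by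
  have hLv : ∀ t, AnalyticOnNhd 𝕜 (fun v i => L v i t) W := fun t v hv =>
    AnalyticAt.pi fun i => hL i t v hv
  have hLd : ∀ v ∈ W, ∀ i j, DifferentiableAt 𝕜 (fun v => L v i j) v := fun v hv i j =>
    (hL i j v hv).differentiableAt
  have hhd : ∀ v ∈ W, ∀ i j, DifferentiableAt 𝕜 (fun v => h v i j) v := fun v hv i j =>
    (hh i j v hv).differentiableAt
  let J : Fin N → (Fin N → 𝕜) → Matrix (Fin N) (Fin N) 𝕜 := fun t v =>
    Matrix.of fun j s => partialDeriv (fun v => L v j t) s v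
  -- The components of the bivector in the frame: `h = L H Lᵀ`.
  let H : (Fin N → 𝕜) → Matrix (Fin N) (Fin N) 𝕜 := fun v => (L v)⁻¹ * h v * ((L v)⁻¹)ᵀ
  -- This is `[L_t, L_p] = D_t L_p - J_t L_p`, where `D_t` is the derivative along `L_t`.
  have hDL : ∀ t, ∀ v ∈ W, matDeriv L v (fun i => L v i t) = J t v * L v + L v * adMatrix c t := by
    intro t v hv
    ext j p
    have h1 := congrFun (hcol t p v hv) j
    rw [lieBracket_coord ((hLv t v hv).differentiableAt) ((hLv p v hv).differentiableAt)] at h1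
    simp only [matDeriv, of_apply, Matrix.add_apply, mul_apply, J, adMatrix]
    rw [sum_partialDeriv_mul (hLd v hv j t), eq_add_of_sub_eq h1, add_comm]
    congr 1
    simp [mul_comm]
  have hDh : ∀ t, ∀ v ∈ W, matDeriv h v (fun i => L v i t) =
      h v * (J t v)ᵀ + J t v * h v + L v * cobracketMatrix γ t * (L v)ᵀ := by
    intro t v hv
    ext i j
    have h1 := hass t i j v hv
    rw [Finset.sum_sub_distrib, Finset.sum_sub_distrib, sum_partialDeriv_mul (hhd v hv i j)] at h1
    simp only [matDeriv, of_apply, Matrix.add_apply, mul_apply, J, transpose_apply,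
      cobracketMatrix]
    rw [eq_add_of_sub_eq (eq_add_of_sub_eq h1)]
    have h2 : ∑ p, ∑ q, γ p q t * L v i p * L v j q =
        ∑ x, (∑ x_1, L v i x_1 * γ x_1 x t) * L v j x := by
      rw [Finset.sum_comm]
      refine Finset.sum_congr rfl fun x _ => ?_
      rw [Finset.sum_mul]
      exact Finset.sum_congr rfl fun y _ => by ring
    rw [h2]
    simp only [mul_comm (partialDeriv _ _ _)]
    ring
  have hHa : ∀ i j, AnalyticOnNhd 𝕜 (fun v => H v i j) W := fun i j v hv =>
    analyticAt_matrix_mul (fun i j => analyticAt_matrix_mul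
      (fun i j => analyticAt_inv_apply (fun i j => hL i j v hv) (hdet v hv) i j)
      (fun i j => hh i j v hv) i j)
      (fun i j => analyticAt_inv_apply (fun i j => hL i j v hv) (hdet v hv) j i) i j
  have hHd : ∀ v ∈ W, ∀ i j, DifferentiableAt 𝕜 (fun v => H v i j) v := fun v hv i j =>
    (hHa i j v hv).differentiableAt
  have hu : ∀ v ∈ W, IsUnit (L v).det := fun v hv => isUnit_iff_ne_zero.2 (hdet v hv)
  have hut : ∀ v ∈ W, IsUnit (L v)ᵀ.det := fun v hv => by rw [det_transpose]; exact hu v hv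
  have hfac : ∀ v ∈ W, h v = L v * H v * (L v)ᵀ := by
    intro v hv
    simp only [H, transpose_nonsing_inv, Matrix.mul_assoc,
      Matrix.nonsing_inv_mul _ (hut v hv), Matrix.mul_one]
    rw [← Matrix.mul_assoc, Matrix.mul_nonsing_inv _ (hu v hv), Matrix.one_mul]
  -- In the frame the Jacobian terms `J t` cancel, and the Lie derivative becomes a linear equation
  -- with constant coefficients for `H`.
  have hDH : ∀ t, ∀ v ∈ W, matDeriv H v (fun i => L v i t) =
      cobracketMatrix γ t - adMatrix c t * H v - H v * (adMatrix c t)ᵀ := by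
    intro t v hv
    have h1 := hDh t v hv
    rw [matDeriv_congr (Filter.eventually_of_mem (hW.mem_nhds hv) hfac),
      matDeriv_mul (B := fun v => (L v)ᵀ)
        (fun i j => differentiableAt_mul_apply (hLd v hv) (hHd v hv) i j) (fun i j => hLd v hv j i), matDeriv_mul (hLd v hv) (hHd v hv), matDeriv_transpose,
      hDL t v hv, hfac v hv, transpose_add, transpose_mul, transpose_mul] at h1
    have h2 : L v * (matDeriv H v (fun i => L v i t)) * (L v)ᵀ =
        L v * (cobracketMatrix γ t - adMatrix c t * H v - H v * (adMatrix c t)ᵀ) * (L v)ᵀ := by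
      rw [← sub_eq_zero] at h1 ⊢
      rw [← h1]
      noncomm_ring
    have h3 := congrArg (fun A => (L v)⁻¹ * A * ((L v)ᵀ)⁻¹) h2
    simpa only [Matrix.mul_assoc, Matrix.mul_nonsing_inv _ (hut v hv), Matrix.mul_one,
      Matrix.nonsing_inv_mul_cancel_left _ _ (hu v hv)] using h3
  obtain ⟨v, hv⟩ := hne
  have hDDH : ∀ t x, matDeriv (fun v => matDeriv H v (fun i => L v i t)) v x =
      - adMatrix c t * matDeriv H v x - matDeriv H v x * (adMatrix c t)ᵀ := by
    intro t x
    have hcd : ∀ A : Matrix (Fin N) (Fin N) 𝕜, ∀ i j,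
      DifferentiableAt 𝕜 (fun _ : Fin N → 𝕜 => A i j) v := fun A i j => differentiableAt_const _
    rw [matDeriv_congr (Filter.eventually_of_mem (hW.mem_nhds hv) (hDH t)),
      matDeriv_sub (fun i j => ?_) (differentiableAt_mul_apply (hHd v hv) (hcd _)),
      matDeriv_sub (hcd _) (differentiableAt_mul_apply (hcd _) (hHd v hv)),
      matDeriv_mul (hcd _) (hHd v hv), matDeriv_mul (hHd v hv) (hcd _), matDeriv_const,
      matDeriv_const, matDeriv_const]
    · noncomm_ring
    · exact (hcd (cobracketMatrix γ t) i j).fun_sub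
        (differentiableAt_mul_apply (hcd (adMatrix c t)) (hHd v hv) i j)
  -- `D_r D_s - D_s D_r` is the derivative along `[L_r, L_s] = ∑ c_{rs}^e L_e`. After substitution
  -- of `hDH`, the terms containing `H` cancel by `adMatrix_commutator`, and what remains is the
  -- cocycle condition.
  have key : ∑ e, c r s e • matDeriv H v (fun i => L v i e) =
      matDeriv (fun v => matDeriv H v (fun i => L v i s)) v (fun i => L v i r) -
      matDeriv (fun v => matDeriv H v (fun i => L v i r)) v (fun i => L v i s) := by
    ext a b
    have h1 := fderiv_apply_lieBracket (n := minSmoothness 𝕜 2) ((hHa a b v hv).contDiffAt) le_rfl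
      ((hLv s v hv).differentiableAt) ((hLv r v hv).differentiableAt)
    rw [hcol r s v hv, map_sum] at h1
    simp only [matDeriv, Matrix.sum_apply, Matrix.smul_apply, of_apply, Matrix.sub_apply]
    simpa only [map_smul] using h1
  rw [hDDH, hDDH] at key
  simp only [hDH _ v hv, smul_sub, Finset.sum_sub_distrib] at key
  have had := adMatrix_commutator hc r s
  have e1 : ∑ e, c r s e • (adMatrix c e * H v) =
      (adMatrix c r * adMatrix c s - adMatrix c s * adMatrix c r) * H v := by
    rw [had, Finset.sum_mul]; simp
  have e2 : ∑ e, c r s e • (H v * (adMatrix c e)ᵀ) =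
      H v * (adMatrix c r * adMatrix c s - adMatrix c s * adMatrix c r)ᵀ := by
    rw [had, transpose_sum, Finset.mul_sum]; simp
  rw [e1, e2, transpose_sub, transpose_mul, transpose_mul] at key
  have fin : ∑ e, c r s e • cobracketMatrix γ e =
      adMatrix c r * cobracketMatrix γ s + cobracketMatrix γ s * (adMatrix c r)ᵀ -
      adMatrix c s * cobracketMatrix γ r - cobracketMatrix γ r * (adMatrix c s)ᵀ := by
    rw [← sub_eq_zero] at key ⊢
    rw [← key]
    noncomm_ring
  have fpq := congrFun (congrFun fin p) q
  simp only [Matrix.sum_apply, Matrix.smul_apply, smul_eq_mul, Matrix.add_apply, Matrix.sub_apply,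
    mul_apply, cobracketMatrix, adMatrix, of_apply, transpose_apply] at fpq
  rw [fpq, ← Finset.sum_add_distrib, ← Finset.sum_sub_distrib, ← Finset.sum_sub_distrib]
  refine Finset.sum_congr rfl fun e _ => ?_
  rw [hc.skew e s p, hc.skew e s q, hc.skew e r p, hc.skew e r q]
  ring

end DiscretePB

namespace DiscretePB

variable {𝕜 : Type*} [RCLike 𝕜] {N : ℕ}

open VectorField Matrix

/-! ### Non-degenerate brackets of first order -/

/-- The consequences of the Poisson axioms for `{v_n^i, v_n^j} = h^{ij}(v_n)` and
`{v_n^i, v_{n+1}^j} = G^{ij}(v_n, v_{n+1})`: skew-symmetry of `h`, the Jacobi identity for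
`v_n, v_{n+1}, v_{n+2}`, and the Jacobi identity for `v_n, v_n, v_{n+1}`. -/
structure FirstOrderJacobi (W : Set (Fin N → 𝕜)) (h : (Fin N → 𝕜) → Matrix (Fin N) (Fin N) 𝕜)
    (G : (Fin N → 𝕜) → (Fin N → 𝕜) → Matrix (Fin N) (Fin N) 𝕜) : Prop where
  analytic_left : ∀ w ∈ W, ∀ i j, AnalyticOnNhd 𝕜 (fun v => G v w i j) W
  analytic_right : ∀ v ∈ W, ∀ i j, AnalyticOnNhd 𝕜 (fun w => G v w i j) W
  skew : ∀ v ∈ W, ∀ i j, h v i j = -h v j i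
  distinct : ∀ v ∈ W, ∀ w ∈ W, ∀ z ∈ W, ∀ i j k,
    fderiv 𝕜 (fun w => G v w i j) w (fun s => G w z s k) =
      fderiv 𝕜 (fun w => G w z j k) w (fun s => G v w i s)
  mixed : ∀ v ∈ W, ∀ w ∈ W, ∀ i j k,
    fderiv 𝕜 (fun v => h v i j) v (fun s => G v w s k)
      + fderiv 𝕜 (fun v => G v w j k) v (fun s => h v s i)
      - fderiv 𝕜 (fun w => G v w j k) w (fun s => G v w i s)
      - fderiv 𝕜 (fun v => G v w i k) v (fun s => h v s j)
      + fderiv 𝕜 (fun w => G v w i k) w (fun s => G v w j s) = 0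

lemma analyticOnNhd_lieBracket {W : Set (Fin N → 𝕜)} {X Y : (Fin N → 𝕜) → (Fin N → 𝕜)}
    (hX : AnalyticOnNhd 𝕜 X W) (hY : AnalyticOnNhd 𝕜 Y W) :
    AnalyticOnNhd 𝕜 (lieBracket 𝕜 X Y) W := fun v hv => by
  -- The smoothness order `⊤` is analyticity.
  have h1 : ContDiffAt 𝕜 ⊤ (lieBracket 𝕜 X Y) v :=
    (hX v hv).contDiffAt.lieBracket_vectorField (n := ⊤) (hY v hv).contDiffAt le_top
  rw [← contDiffWithinAt_univ] at h1
  exact analyticWithinAt_univ.1 h1.analyticWithinAt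

/-- A non-degenerate leading coefficient factorizes. -/
theorem FirstOrderJacobi.exists_factor {W : Set (Fin N → 𝕜)} (hW : IsOpen W) (hWc : IsConnected W)
    {h : (Fin N → 𝕜) → Matrix (Fin N) (Fin N) 𝕜}
    {G : (Fin N → 𝕜) → (Fin N → 𝕜) → Matrix (Fin N) (Fin N) 𝕜} (hG : FirstOrderJacobi W h G)
    (hdet : ∀ v ∈ W, ∀ w ∈ W, (G v w).det ≠ 0) :
    ∃ L R : (Fin N → 𝕜) → Matrix (Fin N) (Fin N) 𝕜,
      (∀ i j, AnalyticOnNhd 𝕜 (fun v => L v i j) W) ∧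
      (∀ i j, AnalyticOnNhd 𝕜 (fun v => R v i j) W) ∧
      ∀ v ∈ W, ∀ w ∈ W, G v w = L v * R w := by
  obtain ⟨v₀, hv₀⟩ := hWc.nonempty
  have hrow : ∀ v ∈ W, ∀ i, AnalyticOnNhd 𝕜 (fun w j => G v w i j) W := fun v hv i w hw =>
    AnalyticAt.pi fun j => hG.analytic_right v hv i j w hw
  have hcol : ∀ k, AnalyticOnNhd 𝕜 (fun w j => G w v₀ j k) W := fun k w hw =>
    AnalyticAt.pi fun j => hG.analytic_left v₀ hv₀ j k w hw
  have hcomm : ∀ v ∈ W, ∀ i k, ∀ w ∈ W,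
      lieBracket 𝕜 (fun w j => G w v₀ j k) (fun w j => G v w i j) w = 0 := by
    intro v hv i k w hw
    ext j
    rw [lieBracket_coord (hcol k w hw).differentiableAt (hrow v hv i w hw).differentiableAt,
      hG.distinct v hv w hw v₀ hv₀ i j k, sub_self, Pi.zero_apply]
  have hcomb : ∀ v ∈ W, ∀ i, ∃ a : Fin N → 𝕜, ∀ w ∈ W,
      (fun j => G v w i j) = ∑ p, a p • fun j => G v₀ w p j := fun v hv i =>
    exists_const_combination hW hWc (X := fun p w j => G v₀ w p j) (Y := fun k w j => G w v₀ j k)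
      (hrow v₀ hv₀) (hrow v hv i)
      (fun w hw => by
        rw [show frameMatrix (fun p w j => G v₀ w p j) w = (G v₀ w)ᵀ from rfl, det_transpose]
        exact hdet v₀ hv₀ w hw)
      (fun w hw => hdet w hw v₀ hv₀) (fun p q w hw => hcomm v₀ hv₀ p q w hw)
      (fun q w hw => hcomm v hv i q w hw)
  -- If `G v w = A(v) G v₀ w`, then setting `w = v₀` identifies `A(v)`, and this formula shows that
  -- it is analytic in `v`.
  refine ⟨fun v => G v v₀ * (G v₀ v₀)⁻¹, fun w => G v₀ w, fun i j v hv => ?_,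
    hG.analytic_right v₀ hv₀, fun v hv w hw => ?_⟩
  · exact analyticAt_matrix_mul (B := fun _ => (G v₀ v₀)⁻¹)
      (fun i j => hG.analytic_left v₀ hv₀ i j v hv) (fun _ _ => analyticAt_const) i j
  · choose a ha using hcomb v hv
    have hA : ∀ w ∈ W, G v w = Matrix.of a * G v₀ w := fun w hw => by
      ext i j
      simpa [mul_apply] using congrFun (ha i w hw) j
    beta_reduce
    rw [hA w hw, hA v₀ hv₀, Matrix.mul_nonsing_inv_cancel_right _ _
      (isUnit_iff_ne_zero.2 (hdet v₀ hv₀ v₀ hv₀))]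

lemma fderiv_mul_const_left {A R : (Fin N → 𝕜) → Matrix (Fin N) (Fin N) 𝕜}
    {B : Matrix (Fin N) (Fin N) 𝕜} {w : Fin N → 𝕜}
    (hA : ∀ᶠ w in nhds w, A w = B * R w)
    (hR : ∀ i j, DifferentiableAt 𝕜 (fun v => R v i j) w) (i j : Fin N) (x : Fin N → 𝕜) :
    fderiv 𝕜 (fun w => A w i j) w x = ∑ p, B i p * fderiv 𝕜 (fun w => R w p j) w x := by
  have h1 : (fun w => A w i j) =ᶠ[nhds w] fun w => ∑ p, B i p * R w p j :=
    hA.mono fun w hw => by simp only [hw, mul_apply]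
  rw [h1.fderiv_eq, fderiv_fun_sum (fun p _ => (hR p j).const_mul _)]
  simp [fderiv_const_mul, hR]

lemma fderiv_mul_const_right {A L : (Fin N → 𝕜) → Matrix (Fin N) (Fin N) 𝕜}
    {B : Matrix (Fin N) (Fin N) 𝕜} {w : Fin N → 𝕜}
    (hA : ∀ᶠ w in nhds w, A w = L w * B)
    (hL : ∀ i j, DifferentiableAt 𝕜 (fun v => L v i j) w) (i j : Fin N) (x : Fin N → 𝕜) :
    fderiv 𝕜 (fun w => A w i j) w x = ∑ p, fderiv 𝕜 (fun w => L w i p) w x * B p j := by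
  have h1 : (fun w => A w i j) =ᶠ[nhds w] fun w => ∑ p, L w i p * B p j :=
    hA.mono fun w hw => by simp only [hw, mul_apply]
  rw [h1.fderiv_eq, fderiv_fun_sum (fun p _ => (hL i p).mul_const _)]
  simp [fderiv_mul_const, hL, mul_comm]

/-- A factorization of a non-degenerate first-order bracket determines a Lie bialgebra. -/
theorem FirstOrderJacobi.hasLieBialgebra {W : Set (Fin N → 𝕜)} (hW : IsOpen W)
    (hWc : IsConnected W) {h L R : (Fin N → 𝕜) → Matrix (Fin N) (Fin N) 𝕜}
    {G : (Fin N → 𝕜) → (Fin N → 𝕜) → Matrix (Fin N) (Fin N) 𝕜} (hG : FirstOrderJacobi W h G)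
    (hdet : ∀ v ∈ W, ∀ w ∈ W, (G v w).det ≠ 0)
    (hh : ∀ i j, AnalyticOnNhd 𝕜 (fun v => h v i j) W)
    (hL : ∀ i j, AnalyticOnNhd 𝕜 (fun v => L v i j) W)
    (hR : ∀ i j, AnalyticOnNhd 𝕜 (fun v => R v i j) W)
    (hfac : ∀ v ∈ W, ∀ w ∈ W, G v w = L v * R w) :
    ∃ c γ, HasLieBialgebra W h G L R c γ := by
  obtain ⟨v₀, hv₀⟩ := hWc.nonempty
  have hLdet : ∀ v ∈ W, (L v).det ≠ 0 := fun v hv h0 => hdet v hv v hv (by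
    rw [hfac v hv v hv, det_mul, h0, zero_mul])
  have hRdet : ∀ v ∈ W, (R v).det ≠ 0 := fun v hv h0 => hdet v hv v hv (by
    rw [hfac v hv v hv, det_mul, h0, mul_zero])
  have hLv : ∀ t, AnalyticOnNhd 𝕜 (fun v i => L v i t) W := fun t v hv =>
    AnalyticAt.pi fun i => hL i t v hv
  have hRv : ∀ t, AnalyticOnNhd 𝕜 (fun v j => R v t j) W := fun t v hv =>
    AnalyticAt.pi fun j => hR t j v hv
  have hLfr : ∀ v ∈ W, (frameMatrix (fun t v i => L v i t) v).det ≠ 0 := hLdet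
  have hRfr : ∀ v ∈ W, (frameMatrix (fun t v j => R v t j) v).det ≠ 0 := fun v hv => by
    rw [show frameMatrix (fun t v j => R v t j) v = (R v)ᵀ from rfl, det_transpose]
    exact hRdet v hv
  have hLd : ∀ v ∈ W, ∀ i j, DifferentiableAt 𝕜 (fun v => L v i j) v := fun v hv i j =>
    (hL i j v hv).differentiableAt
  have hRd : ∀ v ∈ W, ∀ i j, DifferentiableAt 𝕜 (fun v => R v i j) v := fun v hv i j =>
    (hR i j v hv).differentiableAt
  have hGr : ∀ v ∈ W, ∀ w ∈ W, ∀ i j x, fderiv 𝕜 (fun w => G v w i j) w x =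
      ∑ p, L v i p * fderiv 𝕜 (fun w => R w p j) w x := fun v hv w hw i j x =>
    fderiv_mul_const_left (Filter.eventually_of_mem (hW.mem_nhds hw) (hfac v hv)) (hRd w hw) i j x
  have hGl : ∀ v ∈ W, ∀ w ∈ W, ∀ i j x, fderiv 𝕜 (fun v => G v w i j) v x =
      ∑ p, fderiv 𝕜 (fun v => L v i p) v x * R w p j := fun v hv w hw i j x =>
    fderiv_mul_const_right (Filter.eventually_of_mem (hW.mem_nhds hv)
      (fun v hv => hfac v hv w hw)) (hLd v hv) i j x
  have hGc : ∀ v ∈ W, ∀ w ∈ W, ∀ k, (fun s => G v w s k) = ∑ t, R w t k • fun s => L v s t :=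
    fun v hv w hw k => by
      ext s; simp [hfac v hv w hw, mul_apply, mul_comm]
  have hGrow : ∀ v ∈ W, ∀ w ∈ W, ∀ i, (fun s => G v w i s) = ∑ t, L v i t • fun s => R w t s :=
    fun v hv w hw k => by
      ext s; simp [hfac v hv w hw, mul_apply]
  have hcomm : ∀ p q, ∀ v ∈ W,
      lieBracket 𝕜 (fun v i => L v i p) (fun v j => R v q j) v = 0 := by
    intro p q v hv
    ext j
    let B : Matrix (Fin N) (Fin N) 𝕜 := Matrix.of fun q p =>
      lieBracket 𝕜 (fun v i => L v i p) (fun v j => R v q j) v j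
    -- The Jacobi identity for three different cells, all placed at the same point `v`, is the
    -- commutator `[L_p, R^q]` multiplied by the invertible matrices `L` and `R`.
    have hB : L v * B * R v = 0 := by
      ext i k
      have h1 := hG.distinct v hv v hv v hv i j k
      rw [hGr v hv v hv, hGl v hv v hv, hGc v hv v hv, hGrow v hv v hv, ← sub_eq_zero] at h1
      simp only [map_sum, map_smul, smul_eq_mul, Finset.mul_sum, Finset.sum_mul] at h1
      rw [Finset.sum_comm (f := fun i_1 i_2 => _ * _ * R v i_1 k), ← Finset.sum_sub_distrib] at h1
      simp only [mul_apply, Finset.sum_mul, B, of_apply, Matrix.zero_apply]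
      rw [Finset.sum_comm, ← h1]
      refine Finset.sum_congr rfl fun x _ => ?_
      rw [← Finset.sum_sub_distrib]
      refine Finset.sum_congr rfl fun y _ => ?_
      rw [lieBracket_coord (hLv y v hv).differentiableAt (hRv x v hv).differentiableAt]
      ring
    have hB0 : B = 0 := by
      have h2 := congrArg (fun A => (L v)⁻¹ * A * (R v)⁻¹) hB
      simpa only [Matrix.mul_assoc, Matrix.mul_nonsing_inv _ (isUnit_iff_ne_zero.2 (hRdet v hv)),
        Matrix.mul_one, Matrix.nonsing_inv_mul_cancel_left _ _
        (isUnit_iff_ne_zero.2 (hLdet v hv)), Matrix.mul_zero, Matrix.zero_mul] using h2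
    exact congrFun (congrFun hB0 q) p
  have hcomm' : ∀ p q, ∀ v ∈ W,
      lieBracket 𝕜 (fun v j => R v q j) (fun v i => L v i p) v = 0 := fun p q v hv => by
    rw [lieBracket_swap, hcomm p q v hv, neg_zero]
  have hcd2 : ∀ {X : (Fin N → 𝕜) → (Fin N → 𝕜)}, AnalyticOnNhd 𝕜 X W → ∀ v ∈ W,
      ContDiffAt 𝕜 (minSmoothness 𝕜 2) X v := fun hX v hv => (hX v hv).contDiffAt
  -- a commutator of two fields commutes with whatever both of them commute with
  have hnest : ∀ X Y Z : (Fin N → 𝕜) → (Fin N → 𝕜), AnalyticOnNhd 𝕜 X W → AnalyticOnNhd 𝕜 Y W →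
      AnalyticOnNhd 𝕜 Z W → (∀ v ∈ W, lieBracket 𝕜 Z X v = 0) → (∀ v ∈ W, lieBracket 𝕜 Z Y v = 0) →
      ∀ v ∈ W, lieBracket 𝕜 Z (lieBracket 𝕜 X Y) v = 0 := by
    intro X Y Z hX hY hZ h1 h2 v hv
    have e1 : lieBracket 𝕜 Z X =ᶠ[nhds v] 0 := Filter.eventually_of_mem (hW.mem_nhds hv) h1
    have e2 : lieBracket 𝕜 Z Y =ᶠ[nhds v] 0 := Filter.eventually_of_mem (hW.mem_nhds hv) h2
    rw [leibniz_identity_lieBracket le_rfl (hcd2 hZ v hv) (hcd2 hX v hv) (hcd2 hY v hv),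
      e1.lieBracket_vectorField_eq Filter.EventuallyEq.rfl,
      Filter.EventuallyEq.rfl.lieBracket_vectorField_eq e2]
    simp
  have hc : ∀ p q, ∃ c : Fin N → 𝕜, ∀ v ∈ W,
      lieBracket 𝕜 (fun v i => L v i p) (fun v i => L v i q) v = ∑ r, c r • fun i => L v i r :=
    fun p q => exists_const_combination hW hWc (X := fun t v i => L v i t)
      (Y := fun t v j => R v t j) hLv (analyticOnNhd_lieBracket (hLv p) (hLv q)) hLfr hRfr hcomm'
      (fun t => hnest _ _ _ (hLv p) (hLv q) (hRv t) (hcomm' p t) (hcomm' q t))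
  have hγ : ∀ p q, ∃ c : Fin N → 𝕜, ∀ v ∈ W,
      lieBracket 𝕜 (fun v i => R v p i) (fun v i => R v q i) v = ∑ r, c r • fun i => R v r i :=
    fun p q => exists_const_combination hW hWc (X := fun t v j => R v t j)
      (Y := fun t v i => L v i t) hRv (analyticOnNhd_lieBracket (hRv p) (hRv q)) hRfr hLfr
      (fun p q => hcomm q p)
      (fun t => hnest _ _ _ (hRv p) (hRv q) (hLv t) (hcomm t p) (hcomm t q))
  choose c hc using hc
  choose γ hγ using hγ
  have hass : ∀ t i j, ∀ v ∈ W,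
      ∑ s, (partialDeriv (fun v => h v i j) s v * L v s t
        - h v i s * partialDeriv (fun v => L v j t) s v
        - h v s j * partialDeriv (fun v => L v i t) s v) =
      ∑ p, ∑ q, γ p q t * L v i p * L v j q := by
    intro t i j v hv
    have hlhs : ∀ t, ∑ s, (partialDeriv (fun v => h v i j) s v * L v s t
        - h v i s * partialDeriv (fun v => L v j t) s v
        - h v s j * partialDeriv (fun v => L v i t) s v) =
        fderiv 𝕜 (fun v => h v i j) v (fun s => L v s t)
        + fderiv 𝕜 (fun v => L v j t) v (fun s => h v s i)
        - fderiv 𝕜 (fun v => L v i t) v (fun s => h v s j) := fun t => by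
      rw [← sum_partialDeriv_mul (hh i j v hv).differentiableAt, ← sum_partialDeriv_mul
        (hLd v hv j t), ← sum_partialDeriv_mul (hLd v hv i t), ← Finset.sum_add_distrib,
        ← Finset.sum_sub_distrib]
      refine Finset.sum_congr rfl fun s _ => ?_
      rw [hG.skew v hv i s]
      ring
    rw [hlhs]
    -- The difference of the two sides for each `t`. The Jacobi identity for two equal cells only
    -- controls its contraction with `R v`, which is enough because `R v` is invertible.
    let A : Fin N → 𝕜 := fun t => fderiv 𝕜 (fun v => h v i j) v (fun s => L v s t)
        + fderiv 𝕜 (fun v => L v j t) v (fun s => h v s i)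
        - fderiv 𝕜 (fun v => L v i t) v (fun s => h v s j)
        - ∑ p, ∑ q, γ p q t * L v i p * L v j q
    have hA : A ᵥ* R v = 0 := by
      ext k
      have h1 := hG.mixed v hv v hv i j k
      -- The two terms that differentiate the second cell combine into `[R^p, R^q]`, and so bring in
      -- `γ`.
      have h2 : fderiv 𝕜 (fun w => G v w i k) v (fun s => G v v j s)
          - fderiv 𝕜 (fun w => G v w j k) v (fun s => G v v i s) =
          -∑ t, (∑ p, ∑ q, γ p q t * L v i p * L v j q) * R v t k := by
        rw [hGr v hv v hv, hGr v hv v hv, hGrow v hv v hv, hGrow v hv v hv]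
        simp only [map_sum, map_smul, smul_eq_mul, Finset.mul_sum, Finset.sum_mul]
        rw [Finset.sum_comm (f := fun q p => L v j q * _), ← Finset.sum_sub_distrib,
          Finset.sum_comm, ← Finset.sum_neg_distrib]
        refine Finset.sum_congr rfl fun p _ => ?_
        rw [← Finset.sum_sub_distrib, Finset.sum_comm, ← Finset.sum_neg_distrib]
        refine Finset.sum_congr rfl fun q _ => ?_
        have h3 := congrFun (hγ p q v hv) k
        rw [lieBracket_coord (hRv p v hv).differentiableAt (hRv q v hv).differentiableAt] at h3
        have h4 : ∑ t, γ p q t * L v i p * L v j q * R v t k =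
            L v i p * L v j q * ∑ t, γ p q t * R v t k := by
          rw [Finset.mul_sum]
          exact Finset.sum_congr rfl fun t _ => by ring
        simp only [Finset.sum_apply, Pi.smul_apply, smul_eq_mul] at h3
        rw [h4, ← h3]
        ring
      rw [hGc v hv v hv, hGl v hv v hv, hGl v hv v hv, map_sum] at h1
      simp only [vecMul, dotProduct, A, Pi.zero_apply, sub_mul, add_mul, Finset.sum_add_distrib,
        Finset.sum_sub_distrib]
      rw [← h1]
      simp only [map_smul, smul_eq_mul, mul_comm (R v _ k)]
      linear_combination -h2
    have hA0 : A = 0 := Matrix.eq_zero_of_vecMul_eq_zero (hRdet v hv) hA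
    exact sub_eq_zero.1 (congrFun hA0 t)
  have hcL : IsLieConstants c := isLieConstants_of_frame hW ⟨v₀, hv₀⟩ hLv hLfr hc
  have hind : ∀ X : Fin N → (Fin N → 𝕜) → (Fin N → 𝕜), (frameMatrix X v₀).det ≠ 0 →
      LinearIndependent 𝕜 (fun s => W.domRestrict (X s)) := by
    intro X hX
    rw [Fintype.linearIndependent_iff]
    intro a ha
    have hli := linearIndependent_of_frameMatrix hX
    exact Fintype.linearIndependent_iff.1 hli a (by
      simpa using congrFun ha ⟨v₀, hv₀⟩)
  exact ⟨c, γ, hL, hR, hfac, ⟨hind _ (hLfr v₀ hv₀), hc⟩, ⟨hind _ (hRfr v₀ hv₀), hγ⟩,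
    ⟨hcL, isLieConstants_of_frame hW ⟨v₀, hv₀⟩ hRv hRfr hγ,
      cocycle_of_associated hW ⟨v₀, hv₀⟩ hh hL hLdet hcL hc hass⟩, hcomm, hass⟩

end DiscretePB

namespace DiscretePB

variable {𝕜 : Type*} [RCLike 𝕜] {N : ℕ}

open Matrix

/-! ### Reindexing a Poisson bracket -/

lemma partialDeriv_comp_equiv {ι κ : Type*} [DecidableEq ι] [DecidableEq κ] (e : ι ≃ κ)
    (F : (κ → 𝕜) → 𝕜) (s : ι) (x : ι → 𝕜) :
    partialDeriv (fun x => F (x ∘ e.symm)) s x = partialDeriv F (e s) (x ∘ e.symm) := by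
  simp only [partialDeriv, Function.update_comp_equiv, Equiv.symm_symm, Function.comp_apply,
    Equiv.symm_apply_apply]

/-- Used twice: to regroup the lattice into cells, and to reflect it. -/
lemma IsPoisson.reindex {ι κ : Type*} [DecidableEq ι] [DecidableEq κ] (e : ι ≃ κ) {U : Set 𝕜}
    {P : κ → κ → (κ → 𝕜) → 𝕜} (hP : IsPoisson (box κ U) P) :
    IsPoisson (box ι U) (fun a b x => P (e a) (e b) (x ∘ e.symm)) := by
  have hbr : ∀ (F : (κ → 𝕜) → 𝕜) c x, bracketWithCoord
      (fun a b (x : ι → 𝕜) => P (e a) (e b) (x ∘ e.symm)) (fun x => F (x ∘ e.symm)) c x =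
      bracketWithCoord P F (e c) (x ∘ e.symm) := by
    intro F c x
    simp only [bracketWithCoord, partialDeriv_comp_equiv]
    exact finsum_comp_equiv e
      (f := fun s => partialDeriv F s (x ∘ e.symm) * P s (e c) (x ∘ e.symm))
  have hx : ∀ x ∈ box ι U, x ∘ e.symm ∈ box κ U := fun x hx k => hx _
  refine ⟨fun a b x h => hP.skew _ _ _ (hx x h), fun a b c x h => ?_⟩
  rw [hbr (P (e a) (e b)), hbr (P (e b) (e c)), hbr (P (e c) (e a))]
  exact hP.jacobi _ _ _ _ (hx x h)

/-! ### The Jacobi identity of a first-order bracket -/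

lemma partialDeriv_eq_zero {ι : Type*} [DecidableEq ι] {F : (ι → 𝕜) → 𝕜} {s : ι} {x : ι → 𝕜}
    (h : ∀ t, F (Function.update x s t) = F x) : partialDeriv F s x = 0 := by
  simp [partialDeriv, h]

lemma update_cell_same {K : Type*} (x : ℤ × Fin N → K) (n : ℤ) (s : Fin N) (t : K) :
    (fun i => Function.update x (n, s) t (n, i)) =
      Function.update (fun i => x (n, i)) s t := by
  ext i
  by_cases h : i = s
  · subst h; simp
  · simp [h]

lemma update_cell_of_ne {K : Type*} (x : ℤ × Fin N → K) {n m : ℤ} (hnm : m ≠ n) (s : Fin N)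
    (t : K) :
    (fun i => Function.update x (n, s) t (m, i)) = fun i => x (m, i) := by
  ext i
  simp [hnm]

lemma partialDeriv_cell_left (Φ : (Fin N → 𝕜) → (Fin N → 𝕜) → 𝕜) (x : ℤ × Fin N → 𝕜) {n m : ℤ}
    (hnm : m ≠ n) (s : Fin N) :
    partialDeriv (fun x : ℤ × Fin N → 𝕜 => Φ (fun i => x (n, i)) fun i => x (m, i)) (n, s) x =
      partialDeriv (fun v => Φ v fun i => x (m, i)) s fun i => x (n, i) := by
  simp only [partialDeriv, update_cell_same, update_cell_of_ne x hnm]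

lemma partialDeriv_cell_right (Φ : (Fin N → 𝕜) → (Fin N → 𝕜) → 𝕜) (x : ℤ × Fin N → 𝕜) {n m : ℤ}
    (hnm : n ≠ m) (s : Fin N) :
    partialDeriv (fun x : ℤ × Fin N → 𝕜 => Φ (fun i => x (n, i)) fun i => x (m, i)) (m, s) x =
      partialDeriv (fun w => Φ (fun i => x (n, i)) w) s fun i => x (m, i) := by
  simp only [partialDeriv, update_cell_same, update_cell_of_ne x hnm]

lemma partialDeriv_cell_of_ne (Φ : (Fin N → 𝕜) → (Fin N → 𝕜) → 𝕜) (x : ℤ × Fin N → 𝕜) {n m l : ℤ}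
    (hn : n ≠ l) (hm : m ≠ l) (s : Fin N) :
    partialDeriv (fun x : ℤ × Fin N → 𝕜 => Φ (fun i => x (n, i)) fun i => x (m, i)) (l, s) x =
      0 := by
  simp only [partialDeriv, update_cell_of_ne x hn, update_cell_of_ne x hm, deriv_const]

lemma partialDeriv_neg {ι : Type*} [DecidableEq ι] (F : (ι → 𝕜) → 𝕜) (s : ι) (x : ι → 𝕜) :
    partialDeriv (fun x => -F x) s x = -partialDeriv F s x := by
  simp [partialDeriv, deriv.fun_neg]

/-- The bracket with a coordinate of a function of two cells. -/
lemma bracketWithCoord_cells (P : ℤ × Fin N → ℤ × Fin N → (ℤ × Fin N → 𝕜) → 𝕜)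
    (Φ : (Fin N → 𝕜) → (Fin N → 𝕜) → 𝕜) {n m : ℤ} (hnm : n ≠ m) (c : ℤ × Fin N)
    (x : ℤ × Fin N → 𝕜) :
    bracketWithCoord P (fun x => Φ (fun i => x (n, i)) fun i => x (m, i)) c x =
      ∑ s, partialDeriv (fun v => Φ v fun i => x (m, i)) s (fun i => x (n, i)) * P (n, s) c x +
      ∑ s, partialDeriv (fun w => Φ (fun i => x (n, i)) w) s (fun i => x (m, i)) *
        P (m, s) c x := by
  rw [bracketWithCoord, finsum_eq_sum_of_support_subset (s := ({n, m} : Finset ℤ) ×ˢ Finset.univ),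
    Finset.sum_product, Finset.sum_pair hnm]
  · simp only [partialDeriv_cell_left Φ x hnm.symm, partialDeriv_cell_right Φ x hnm]
  · rintro ⟨l, s⟩ hl
    by_contra hcon
    simp only [Finset.coe_product, Set.mem_prod, Finset.mem_coe, Finset.mem_insert,
      Finset.mem_singleton, Finset.mem_univ, and_true, not_or] at hcon
    exact hl (by
      beta_reduce
      rw [partialDeriv_cell_of_ne Φ x (Ne.symm hcon.1) (Ne.symm hcon.2), zero_mul])

section

variable (h : (Fin N → 𝕜) → Matrix (Fin N) (Fin N) 𝕜)
    (G : (Fin N → 𝕜) → (Fin N → 𝕜) → Matrix (Fin N) (Fin N) 𝕜)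

lemma firstOrderBracket_same (n : ℤ) (i j : Fin N) :
    firstOrderBracket h G (n, i) (n, j) = fun x => h (fun s => x (n, s)) i j := by
  ext x; simp [firstOrderBracket]

lemma firstOrderBracket_succ {n m : ℤ} (hm : m = n + 1) (i j : Fin N) :
    firstOrderBracket h G (n, i) (m, j) =
      fun x => G (fun s => x (n, s)) (fun s => x (m, s)) i j := by
  ext x; subst hm; simp [firstOrderBracket]

lemma firstOrderBracket_pred {n m : ℤ} (hm : m = n + 1) (i j : Fin N) :
    firstOrderBracket h G (m, i) (n, j) =
      fun x => -G (fun s => x (n, s)) (fun s => x (m, s)) j i := by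
  ext x; subst hm
  simp [firstOrderBracket, add_assoc]

lemma firstOrderBracket_far {n m : ℤ} (hm : n + 1 < m ∨ m + 1 < n) (i j : Fin N) :
    firstOrderBracket h G (n, i) (m, j) = 0 := by
  ext x
  simp only [firstOrderBracket, Pi.zero_apply]
  rw [if_neg (by lia), if_neg (by lia), if_neg (by lia)]

end

theorem IsPoisson.firstOrderJacobi {U : Set 𝕜} {h : (Fin N → 𝕜) → Matrix (Fin N) (Fin N) 𝕜}
    {G : (Fin N → 𝕜) → (Fin N → 𝕜) → Matrix (Fin N) (Fin N) 𝕜}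
    (hP : IsPoisson (box (ℤ × Fin N) U) (firstOrderBracket h G))
    (hh : ∀ i j, AnalyticOnNhd 𝕜 (fun v => h v i j) (box (Fin N) U))
    (hGa : ∀ i j, AnalyticOnNhd 𝕜 (fun x : (Fin N → 𝕜) × (Fin N → 𝕜) => G x.1 x.2 i j)
      (box (Fin N) U ×ˢ box (Fin N) U)) :
    FirstOrderJacobi (box (Fin N) U) h G := by
  have hl : ∀ w ∈ box (Fin N) U, ∀ i j, AnalyticOnNhd 𝕜 (fun v => G v w i j) (box (Fin N) U) :=
    fun w hw i j v hv => AnalyticAt.fun_comp (g := fun x : (Fin N → 𝕜) × (Fin N → 𝕜) => G x.1 x.2 i j)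
      (f := fun v => (v, w)) (hGa i j (v, w) ⟨hv, hw⟩) (analyticAt_id.prod analyticAt_const)
  have hr : ∀ v ∈ box (Fin N) U, ∀ i j, AnalyticOnNhd 𝕜 (fun w => G v w i j) (box (Fin N) U) :=
    fun v hv i j w hw => AnalyticAt.fun_comp (g := fun x : (Fin N → 𝕜) × (Fin N → 𝕜) => G x.1 x.2 i j)
      (f := fun w => (v, w)) (hGa i j (v, w) ⟨hv, hw⟩) (analyticAt_const.prod analyticAt_id)
  -- A configuration with prescribed cells `0`, `1`, `2`; the other cells do not enter.
  let X : (Fin N → 𝕜) → (Fin N → 𝕜) → (Fin N → 𝕜) → (ℤ × Fin N → 𝕜) := fun v w z a =>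
    if a.1 = 0 then v a.2 else if a.1 = 1 then w a.2 else z a.2
  have hX : ∀ v ∈ box (Fin N) U, ∀ w ∈ box (Fin N) U, ∀ z ∈ box (Fin N) U,
      X v w z ∈ box (ℤ × Fin N) U := by
    intro v hv w hw z hz a
    simp only [X]
    split_ifs
    exacts [hv _, hw _, hz _]
  have hX0 : ∀ v w z, (fun i => X v w z (0, i)) = v := fun v w z => by ext i; simp [X]
  have hX1 : ∀ v w z, (fun i => X v w z (1, i)) = w := fun v w z => by ext i; simp [X]
  have hX2 : ∀ v w z, (fun i => X v w z (2, i)) = z := fun v w z => by ext i; simp [X]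
  refine ⟨hl, hr, fun v hv i j => ?_, fun v hv w hw z hz i j k => ?_, fun v hv w hw i j k => ?_⟩
  · have h1 := hP.skew (0, i) (0, j) _ (hX v hv v hv v hv)
    simpa only [firstOrderBracket_same, hX0] using h1
  · have h1 := hP.jacobi (0, i) (1, j) (2, k) _ (hX v hv w hw z hz)
    rw [firstOrderBracket_succ h G (zero_add 1).symm,
      firstOrderBracket_succ h G (show (2 : ℤ) = 1 + 1 by norm_num),
      firstOrderBracket_far h G (by norm_num),
      bracketWithCoord_cells _ (fun v w => G v w i j) zero_ne_one,
      bracketWithCoord_cells _ (fun v w => G v w j k) (by norm_num)] at h1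
    simp only [firstOrderBracket_far h G (show (0 : ℤ) + 1 < 2 ∨ (2 : ℤ) + 1 < 0 by norm_num),
      firstOrderBracket_far h G (show (2 : ℤ) + 1 < 0 ∨ (0 : ℤ) + 1 < 2 by norm_num),
      firstOrderBracket_pred h G (zero_add (1 : ℤ)).symm,
      firstOrderBracket_succ h G (show (2 : ℤ) = 1 + 1 by norm_num), hX0, hX1, hX2,
      bracketWithCoord, partialDeriv_eq_zero (F := (0 : (ℤ × Fin N → 𝕜) → 𝕜)) (fun _ => rfl),
      Pi.zero_apply, mul_zero, zero_mul, Finset.sum_const_zero, finsum_zero, zero_add, add_zero,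
      mul_neg, Finset.sum_neg_distrib] at h1
    rw [sum_partialDeriv_mul (hr v hv i j w hw).differentiableAt,
      sum_partialDeriv_mul (hl z hz j k w hw).differentiableAt] at h1
    exact eq_of_sub_eq_zero (by rw [sub_eq_add_neg]; exact h1)
  · have h1 := hP.jacobi (0, i) (0, j) (1, k) _ (hX v hv w hw w hw)
    rw [firstOrderBracket_same, firstOrderBracket_succ h G (zero_add 1).symm,
      firstOrderBracket_pred h G (zero_add 1).symm,
      bracketWithCoord_cells _ (fun v _ => h v i j) zero_ne_one,
      bracketWithCoord_cells _ (fun v w => G v w j k) zero_ne_one,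
      bracketWithCoord_cells _ (fun v w => -G v w i k) zero_ne_one] at h1
    simp only [firstOrderBracket_same, firstOrderBracket_succ h G (zero_add (1 : ℤ)).symm,
      firstOrderBracket_pred h G (zero_add (1 : ℤ)).symm, hX0, hX1, partialDeriv_neg,
      partialDeriv_eq_zero (F := fun _ : Fin N → 𝕜 => h v i j) (fun _ => rfl),
      zero_mul, Finset.sum_const_zero, add_zero,
      mul_neg, neg_mul, neg_neg, Finset.sum_neg_distrib] at h1
    rw [sum_partialDeriv_mul (hh i j v hv).differentiableAt,
      sum_partialDeriv_mul (hl w hw j k v hv).differentiableAt,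
      sum_partialDeriv_mul (hr v hv j k w hw).differentiableAt,
      sum_partialDeriv_mul (hl w hw i k v hv).differentiableAt,
      sum_partialDeriv_mul (hr v hv i k w hw).differentiableAt] at h1
    rw [← h1]
    ring

end DiscretePB

namespace DiscretePB

variable {𝕜 : Type*} [RCLike 𝕜]

open Matrix

/-! ### Consolidation of a scalar bracket -/

lemma apply_congr_size {K : Type*} {g : (k : ℕ) → (Fin (k + 1) → K) → K} {k k' : ℕ} (hk : k = k')
    {x : Fin (k + 1) → K} {x' : Fin (k' + 1) → K}
    (hx : ∀ (t : ℕ) (h : t < k + 1) (h' : t < k' + 1), x ⟨t, h⟩ = x' ⟨t, h'⟩) :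
    g k x = g k' x' := by
  subst hk
  congr 1
  ext ⟨t, ht⟩
  exact hx t ht ht

lemma scalarBracket_swap (M : ℕ) (g : (k : ℕ) → (Fin (k + 1) → 𝕜) → 𝕜) (n m : ℤ) (u : ℤ → 𝕜) :
    scalarBracket M g m n u = -scalarBracket M g n m u := by
  unfold scalarBracket
  rcases lt_trichotomy n m with h | h | h
  · by_cases h' : m ≤ n + M <;> simp [h, h', not_lt.2 h.le]
  · simp [h]
  · by_cases h' : n ≤ m + M <;> simp [h, h', not_lt.2 h.le]

/-- Translation invariance together with locality: only the sites between `n` and `m` matter. With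
`c = 0` it is locality alone. -/
lemma scalarBracket_shift (M : ℕ) (g : (k : ℕ) → (Fin (k + 1) → 𝕜) → 𝕜) {n m n' m' : ℤ} (c : ℤ)
    (hn : n' = n + c) (hm : m' = m + c) {u u' : ℤ → 𝕜}
    (hu : ∀ t, min n m ≤ t → t ≤ max n m → u t = u' (t + c)) :
    scalarBracket M g n m u = scalarBracket M g n' m' u' := by
  subst hn hm
  simp only [scalarBracket, add_lt_add_iff_right]
  have e1 : m + c ≤ n + c + M ↔ m ≤ n + M := by lia
  have e2 : n + c ≤ m + c + M ↔ n ≤ m + M := by lia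
  simp only [e1, e2]
  split_ifs with h1 h2
  · refine apply_congr_size (by simp) fun t ht _ => ?_
    have ht' : t ≤ (m - n).toNat := Nat.lt_succ_iff.1 ht
    rw [hu _ (by lia) (by lia)]
    congr 1; ring
  · congr 1
    refine apply_congr_size (by simp) fun t ht _ => ?_
    have ht' : t ≤ (n - m).toNat := Nat.lt_succ_iff.1 ht
    rw [hu _ (by lia) (by lia)]
    congr 1; ring
  · rfl

lemma scalarBracket_far (M : ℕ) (g : (k : ℕ) → (Fin (k + 1) → 𝕜) → 𝕜) {n m : ℤ}
    (h : n + M < m ∨ m + M < n) (u : ℤ → 𝕜) : scalarBracket M g n m u = 0 := by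
  rw [scalarBracket, if_neg (by lia), if_neg (by lia)]

lemma analyticAt_scalarBracket {E : Type*} [NormedAddCommGroup E] [NormedSpace 𝕜 E] {M : ℕ}
    {g : (k : ℕ) → (Fin (k + 1) → 𝕜) → 𝕜} {U : Set 𝕜}
    (hg : ∀ k, 1 ≤ k → k ≤ M → AnalyticOnNhd 𝕜 (g k) (box (Fin (k + 1)) U))
    {Φ : E → ℤ → 𝕜} {x : E} (hΦ : ∀ t, AnalyticAt 𝕜 (fun x => Φ x t) x) (hx : Φ x ∈ box ℤ U)
    (n m : ℤ) : AnalyticAt 𝕜 (fun x => scalarBracket M g n m (Φ x)) x := by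
  have key : ∀ k, 1 ≤ k → k ≤ M → ∀ n : ℤ,
      AnalyticAt 𝕜 (fun x => g k fun i => Φ x (n + (i : ℕ))) x := fun k h1 h2 n =>
    AnalyticAt.fun_comp (g := g k) (f := fun x (i : Fin (k + 1)) => Φ x (n + (i : ℕ)))
      (hg k h1 h2 _ fun i => hx _) (AnalyticAt.pi fun i => hΦ _)
  unfold scalarBracket
  split_ifs with h1 h2
  · exact key _ (by lia) (by lia) n
  · exact (key _ (by lia) (by lia) m).fun_neg
  · exact analyticAt_const

/-- The coordinates of the pair `(v, w)` of consecutive cells. -/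
def pairCoord {M : ℕ} {K : Type*} [Zero K] (v w : Fin M → K) (t : ℕ) : K :=
  if h : t < M then v ⟨t, h⟩ else if h : t - M < M then w ⟨t - M, h⟩ else 0

lemma pairCoord_mem {M : ℕ} {U : Set 𝕜} {v w : Fin M → 𝕜} (hv : v ∈ box (Fin M) U)
    (hw : w ∈ box (Fin M) U) {t : ℕ} (ht : t < 2 * M) : pairCoord v w t ∈ U := by
  unfold pairCoord
  split_ifs with h1 h2
  exacts [hv _, hw _, (h2 (by lia)).elim]

section

variable (M : ℕ) [NeZero M] (g : (k : ℕ) → (Fin (k + 1) → 𝕜) → 𝕜)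

/-- The lattice variables with given consolidated variables. -/
def unconsolidate {K : Type*} (x : ℤ × Fin M → K) : ℤ → K := x ∘ Int.divModEquiv M

/-- The bracket inside a cell of the consolidated lattice. -/
def cellSame (v : Fin M → 𝕜) : Matrix (Fin M) (Fin M) 𝕜 :=
  -- Only sites of cell `0` enter, so repeating `v` in every cell is harmless.
  Matrix.of fun i j => scalarBracket M g (i : ℕ) (j : ℕ) (unconsolidate M fun a => v a.2)

/-- The bracket of two neighbouring cells of the consolidated lattice. -/
def cellNext (v w : Fin M → 𝕜) : Matrix (Fin M) (Fin M) 𝕜 :=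
  Matrix.of fun i j => scalarBracket M g (i : ℕ) (M + (j : ℕ))
    (unconsolidate M fun a => if a.1 = 0 then v a.2 else w a.2)

lemma divModEquiv_cell (n : ℤ) (i : Fin M) : Int.divModEquiv M (n * M + (i : ℕ)) = (n, i) :=
  (Int.divModEquiv M).apply_symm_apply (n, i)

lemma unconsolidate_cell {K : Type*} (x : ℤ × Fin M → K) (n : ℤ) (i : Fin M) :
    unconsolidate M x (n * M + (i : ℕ)) = x (n, i) := by
  rw [unconsolidate, Function.comp_apply, divModEquiv_cell]

lemma unconsolidate_of_eq {K : Type*} (x : ℤ × Fin M → K) {t n : ℤ} {i : ℕ} (hi : i < M)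
    (ht : t = n * M + i) : unconsolidate M x t = x (n, ⟨i, hi⟩) := by
  rw [ht]; exact unconsolidate_cell M x n ⟨i, hi⟩

lemma unconsolidate_consolidate {K : Type*} (u : ℤ → K) :
    unconsolidate M (fun a => u (a.1 * M + (a.2 : ℕ))) = u := by
  ext t
  exact congrArg u ((Int.divModEquiv M).symm_apply_apply t)

lemma cellSame_eq (x : ℤ × Fin M → 𝕜) (n : ℤ) (i j : Fin M) :
    cellSame M g (fun s => x (n, s)) i j =
      scalarBracket M g (n * M + (i : ℕ)) (n * M + (j : ℕ)) (unconsolidate M x) := by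
  refine scalarBracket_shift M g (n * M) (add_comm _ _) (add_comm _ _) fun t h1 h2 => ?_
  have hi := i.2
  have hj := j.2
  obtain ⟨k, rfl⟩ := Int.eq_ofNat_of_zero_le (show 0 ≤ t by lia)
  rw [unconsolidate_of_eq M _ (n := 0) (i := k) (by lia) (by simp),
    unconsolidate_of_eq M _ (n := n) (i := k) (by lia) (by ring)]

lemma cellNext_eq (x : ℤ × Fin M → 𝕜) (n : ℤ) (i j : Fin M) :
    cellNext M g (fun s => x (n, s)) (fun s => x (n + 1, s)) i j =
      scalarBracket M g (n * M + (i : ℕ)) ((n + 1) * M + (j : ℕ)) (unconsolidate M x) := by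
  refine scalarBracket_shift M g (n * M) (add_comm _ _) (by ring) fun t h1 h2 => ?_
  have hi := i.2
  have hj := j.2
  obtain ⟨k, rfl⟩ := Int.eq_ofNat_of_zero_le (show 0 ≤ t by lia)
  by_cases hk : k < M
  · rw [unconsolidate_of_eq M _ (n := 0) (i := k) hk (by simp),
      unconsolidate_of_eq M _ (n := n) (i := k) hk (by ring)]
    simp
  · rw [unconsolidate_of_eq M _ (n := 1) (i := k - M) (by lia) (by lia),
      unconsolidate_of_eq M _ (n := n + 1) (i := k - M) (by lia)
        (by push_cast [not_lt.1 hk]; ring)]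
    simp

lemma firstOrderBracket_cell (x : ℤ × Fin M → 𝕜) (n m : ℤ) (i j : Fin M) :
    firstOrderBracket (cellSame M g) (cellNext M g) (n, i) (m, j) x =
      scalarBracket M g (n * M + (i : ℕ)) (m * M + (j : ℕ)) (unconsolidate M x) := by
  have hi := i.2
  have hj := j.2
  rcases lt_trichotomy m n with h | h | h
  · rcases eq_or_ne n (m + 1) with h' | h'
    · rw [firstOrderBracket_pred _ _ h', scalarBracket_swap, h']
      beta_reduce
      rw [cellNext_eq]
    · rw [firstOrderBracket_far _ _ (by lia), scalarBracket_far]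
      · rfl
      · right
        nlinarith [show m + 2 ≤ n by lia]
  · subst h
    rw [firstOrderBracket_same]
    exact cellSame_eq M g x m i j
  · rcases eq_or_ne m (n + 1) with h' | h'
    · rw [firstOrderBracket_succ _ _ h', h']
      exact cellNext_eq M g x n i j
    · rw [firstOrderBracket_far _ _ (by lia), scalarBracket_far]
      · rfl
      · left
        nlinarith [show n + 2 ≤ m by lia]

variable {M g}

theorem IsPoisson.consolidated {U : Set 𝕜} (hP : IsPoisson (box ℤ U) (scalarBracket M g)) :
    IsPoisson (box (ℤ × Fin M) U) (firstOrderBracket (cellSame M g) (cellNext M g)) := by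
  have h1 := hP.reindex (Int.divModEquiv M).symm
  have h2 : (fun (a b : ℤ × Fin M) (x : ℤ × Fin M → 𝕜) =>
      scalarBracket M g ((Int.divModEquiv M).symm a) ((Int.divModEquiv M).symm b)
        (x ∘ (Int.divModEquiv M).symm.symm)) =
      firstOrderBracket (cellSame M g) (cellNext M g) := by
    funext a b x
    exact (firstOrderBracket_cell M g x a.1 b.1 a.2 b.2).symm
  rwa [h2] at h1

theorem analyticOnNhd_cellSame {U : Set 𝕜}
    (hg : ∀ k, 1 ≤ k → k ≤ M → AnalyticOnNhd 𝕜 (g k) (box (Fin (k + 1)) U)) (i j : Fin M) :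
    AnalyticOnNhd 𝕜 (fun v => cellSame M g v i j) (box (Fin M) U) := fun v hv =>
  analyticAt_scalarBracket hg (Φ := fun v : Fin M → 𝕜 => unconsolidate M fun a => v a.2)
    (fun _ => (ContinuousLinearMap.proj (R := 𝕜) (φ := fun _ : Fin M => 𝕜) _).analyticAt v)
    (fun _ => hv _) _ _

theorem analyticOnNhd_cellNext {U : Set 𝕜}
    (hg : ∀ k, 1 ≤ k → k ≤ M → AnalyticOnNhd 𝕜 (g k) (box (Fin (k + 1)) U)) (i j : Fin M) :
    AnalyticOnNhd 𝕜 (fun x : (Fin M → 𝕜) × (Fin M → 𝕜) => cellNext M g x.1 x.2 i j)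
      (box (Fin M) U ×ˢ box (Fin M) U) := fun x hx =>
  analyticAt_scalarBracket hg
    (Φ := fun x : (Fin M → 𝕜) × (Fin M → 𝕜) => unconsolidate M fun a =>
      if a.1 = 0 then x.1 a.2 else x.2 a.2)
    (fun _ => by
      simp only [unconsolidate, Function.comp_apply]
      split_ifs
      · exact ((ContinuousLinearMap.proj (R := 𝕜) (φ := fun _ : Fin M => 𝕜) _).comp
          (ContinuousLinearMap.fst 𝕜 (Fin M → 𝕜) (Fin M → 𝕜))).analyticAt x
      · exact ((ContinuousLinearMap.proj (R := 𝕜) (φ := fun _ : Fin M => 𝕜) _).comp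
          (ContinuousLinearMap.snd 𝕜 (Fin M → 𝕜) (Fin M → 𝕜))).analyticAt x)
    (fun _ => by
      simp only [unconsolidate, Function.comp_apply]
      split_ifs
      exacts [hx.1 _, hx.2 _]) _ _

lemma cellNext_apply_of_le (v w : Fin M → 𝕜) {i j : Fin M} (h : j ≤ i) :
    cellNext M g v w i j = g (M + j - i) fun t => pairCoord v w (i + t) := by
  have hi := i.2
  have hj := j.2
  have hji : (j : ℕ) ≤ i := h
  rw [cellNext, of_apply, scalarBracket, if_pos (by lia)]
  refine apply_congr_size (by lia) fun t ht ht' => ?_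
  simp only [pairCoord]
  by_cases h1 : i + t < M
  · rw [dif_pos h1, unconsolidate_of_eq M _ (n := 0) (i := i + t) h1 (by simp), if_pos rfl]
  · rw [dif_neg h1, dif_pos (by lia), unconsolidate_of_eq M _ (n := 1) (i := i + t - M) (by lia)
      (by lia), if_neg one_ne_zero]

lemma cellNext_apply_of_lt (v w : Fin M → 𝕜) {i j : Fin M} (h : i < j) :
    cellNext M g v w i j = 0 := by
  have hji : (i : ℕ) < j := h
  exact scalarBracket_far _ _ (by lia) _

/-- The matrix is lower triangular, and its `i`-th diagonal entry is `g_M` evaluated on the sites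
`i, …, i + M` of the two cells. -/
theorem det_cellNext_ne_zero {U : Set 𝕜} (hg : ∀ x ∈ box (Fin (M + 1)) U, g M x ≠ 0)
    {v w : Fin M → 𝕜} (hv : v ∈ box (Fin M) U) (hw : w ∈ box (Fin M) U) :
    (cellNext M g v w).det ≠ 0 := by
  rw [det_of_isLowerTriangular _ fun i j hij => cellNext_apply_of_lt v w hij]
  refine Finset.prod_ne_zero_iff.2 fun i _ => ?_
  have hi := i.2
  rw [cellNext_apply_of_le v w le_rfl]
  have h1 := hg (fun t => pairCoord v w (i + t)) fun t => pairCoord_mem hv hw (by lia)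
  have h2 : g (M + i - i) (fun t => pairCoord v w (i + t)) = g M fun t => pairCoord v w (i + t) :=
    apply_congr_size (Nat.add_sub_cancel M i) fun t _ _ => rfl
  rwa [h2]

end

end DiscretePB

namespace DiscretePB

variable {𝕜 : Type*} [RCLike 𝕜]

/-! ### The leading coefficient has no zeros -/

lemma box_eq_pi {K ι : Type*} (U : Set K) : {x : ι → K | ∀ i, x i ∈ U} = Set.univ.pi fun _ => U := by
  ext x; simp

lemma isOpen_box {ι : Type*} [Finite ι] {U : Set 𝕜} (hU : IsOpen U) : IsOpen (box ι U) := by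
  rw [box, box_eq_pi]
  exact isOpen_set_pi Set.finite_univ fun _ _ => hU

lemma isConnected_box {ι : Type*} {U : Set 𝕜} (hU : IsConnected U) : IsConnected (box ι U) := by
  rw [box, box_eq_pi]
  exact isConnected_univ_pi.2 fun _ => hU

lemma update_mem_box {K ι : Type*} [DecidableEq ι] {U : Set K} {x : ι → K} (hx : x ∈ box ι U)
    (s : ι) {t : K} (ht : t ∈ U) : Function.update x s t ∈ box ι U := by
  intro i
  by_cases h : i = s
  · subst h; simpa
  · simpa [h] using hx i

lemma partialDeriv_congr_box {ι : Type*} [DecidableEq ι] {U : Set 𝕜} (hU : IsOpen U)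
    {F F' : (ι → 𝕜) → 𝕜} (hF : ∀ x ∈ box ι U, F x = F' x) (s : ι) {x : ι → 𝕜} (hx : x ∈ box ι U) :
    partialDeriv F s x = partialDeriv F' s x :=
  Filter.EventuallyEq.deriv_eq (Filter.eventually_of_mem (hU.mem_nhds (hx s)) fun _ ht =>
    hF _ (update_mem_box hx s ht))

lemma bracketWithCoord_congr_box {ι : Type*} [DecidableEq ι] {U : Set 𝕜} (hU : IsOpen U)
    (P : ι → ι → (ι → 𝕜) → 𝕜) {F F' : (ι → 𝕜) → 𝕜} (hF : ∀ x ∈ box ι U, F x = F' x) (c : ι)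
    {x : ι → 𝕜} (hx : x ∈ box ι U) : bracketWithCoord P F c x = bracketWithCoord P F' c x :=
  finsum_congr fun s => by rw [partialDeriv_congr_box hU hF s hx]

/-- The bracket with a coordinate of a function of finitely many of the coordinates. -/
lemma bracketWithCoord_embedding {ι κ : Type*} [DecidableEq ι] [DecidableEq κ] [Fintype κ]
    (P : ι → ι → (ι → 𝕜) → 𝕜) (e : κ ↪ ι) (f : (κ → 𝕜) → 𝕜) (c : ι) (x : ι → 𝕜) :
    bracketWithCoord P (fun x => f (x ∘ e)) c x =
      ∑ k, partialDeriv f k (x ∘ e) * P (e k) c x := by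
  rw [bracketWithCoord, finsum_eq_sum_of_support_subset (s := Finset.univ.map e), Finset.sum_map]
  · refine Finset.sum_congr rfl fun k _ => ?_
    simp only [partialDeriv, Function.update_comp_eq_of_injective x e.injective,
      Function.comp_apply]
  · intro s hs
    by_contra hcon
    refine hs ?_
    beta_reduce
    rw [partialDeriv_eq_zero fun t => ?_, zero_mul]
    rw [Function.update_comp_eq_of_notMem_range]
    simpa using hcon

/-- A solution of a linear equation `φ' = b φ` which has a zero vanishes identically. -/
lemma eqOn_zero_of_deriv_eq_mul {U : Set 𝕜} (hU : IsOpen U) (hUc : IsPreconnected U)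
    {φ b : 𝕜 → 𝕜} (hφ : AnalyticOnNhd 𝕜 φ U) (hb : AnalyticOnNhd 𝕜 b U)
    (hd : ∀ t ∈ U, deriv φ t = b t * φ t) {t₀ : 𝕜} (ht₀ : t₀ ∈ U) (h0 : φ t₀ = 0) :
    Set.EqOn φ 0 U := by
  refine hφ.eqOn_zero_of_preconnected_of_eventuallyEq_zero hUc ht₀ (analyticOrderAt_eq_top.1 ?_)
  -- At a zero of finite order `n` the derivative has order `n - 1`, whereas `b φ` has order at
  -- least `n`; so the order is infinite.
  have h1 := (hφ t₀ ht₀).analyticOrderAt_deriv_add_one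
  have h2 : deriv φ =ᶠ[nhds t₀] b * φ := Filter.eventually_of_mem (hU.mem_nhds ht₀) hd
  simp only [h0, sub_zero] at h1
  rw [analyticOrderAt_congr h2, analyticOrderAt_mul (hb t₀ ht₀) (hφ t₀ ht₀)] at h1
  by_contra hne
  obtain ⟨n, hn⟩ := ENat.ne_top_iff_exists.1 hne
  have h3 : ((n : ℕ∞) + 1) ≤ n := by
    conv_rhs => rw [hn, ← h1, ← hn]
    gcongr
    exact le_add_self
  exact absurd h3 (by exact_mod_cast Nat.not_succ_le_self n)

/-- The logarithmic derivative of `f` in the direction of the coordinate `k` is analytic. -/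
def HasLogDeriv {ι : Type*} [Fintype ι] [DecidableEq ι] (U : Set 𝕜) (f : (ι → 𝕜) → 𝕜) (k : ι) :
    Prop :=
  ∃ B : (ι → 𝕜) → 𝕜, AnalyticOnNhd 𝕜 B (box ι U) ∧ ∀ y ∈ box ι U, partialDeriv f k y = B y * f y

lemma analyticAt_update {ι : Type*} [Fintype ι] [DecidableEq ι] (x : ι → 𝕜) (k : ι) (t : 𝕜) :
    AnalyticAt 𝕜 (fun t => Function.update x k t) t := by
  refine AnalyticAt.pi fun i => ?_
  by_cases h : i = k
  · subst h; simp only [Function.update_self]; exact analyticAt_id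
  · simpa [h] using analyticAt_const

lemma HasLogDeriv.update_ne_zero {ι : Type*} [Fintype ι] [DecidableEq ι] {U : Set 𝕜}
    (hU : IsOpen U) (hUc : IsPreconnected U) {f : (ι → 𝕜) → 𝕜} (hf : AnalyticOnNhd 𝕜 f (box ι U))
    {k : ι} (hk : HasLogDeriv U f k) {x : ι → 𝕜} (hx : x ∈ box ι U) (h : f x ≠ 0) {t : 𝕜}
    (ht : t ∈ U) : f (Function.update x k t) ≠ 0 := by
  obtain ⟨B, hB, hBf⟩ := hk
  intro h0
  have key := eqOn_zero_of_deriv_eq_mul (φ := fun t => f (Function.update x k t))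
    (b := fun t => B (Function.update x k t)) hU hUc
    (fun t ht => AnalyticAt.fun_comp (hf _ (update_mem_box hx k ht)) (analyticAt_update x k t))
    (fun t ht => AnalyticAt.fun_comp (hB _ (update_mem_box hx k ht)) (analyticAt_update x k t))
    (fun t ht => by
      have h1 := hBf _ (update_mem_box hx k ht)
      simpa [partialDeriv] using h1) ht h0
  have h2 := key (hx k)
  simp only [Function.update_eq_self] at h2
  exact h h2

/-- Whether `f` vanishes does not depend on the coordinates with analytic logarithmic
derivative. -/
lemma ne_zero_of_hasLogDeriv {ι : Type*} [Fintype ι] [DecidableEq ι] {U : Set 𝕜}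
    (hU : IsOpen U) (hUc : IsPreconnected U) {f : (ι → 𝕜) → 𝕜} (hf : AnalyticOnNhd 𝕜 f (box ι U))
    {x z : ι → 𝕜} (hx : x ∈ box ι U) (hz : z ∈ box ι U) (h : f x ≠ 0)
    (hlog : ∀ k, z k ≠ x k → HasLogDeriv U f k) : f z ≠ 0 := by
  -- The coordinates of `x` are replaced by those of `z` one at a time.
  have key : ∀ T : Finset ι, T.piecewise z x ∈ box ι U ∧ f (T.piecewise z x) ≠ 0 := by
    intro T
    induction T using Finset.induction_on with
    | empty => simpa using ⟨hx, h⟩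
    | insert k T hkT ih =>
      rw [Finset.piecewise_insert]
      refine ⟨update_mem_box ih.1 k (hz k), ?_⟩
      by_cases hk : z k = x k
      · rw [Function.update_eq_self_iff.2 (by simp [hkT, hk])]
        exact ih.2
      · exact (hlog k hk).update_ne_zero hU hUc hf ih.1 ih.2 (hz k)
  simpa using (key Finset.univ).2

lemma scalarBracket_leading {M α ξ : ℕ} (hM : M = 2 * α + ξ) {U : Set 𝕜}
    {g : (k : ℕ) → (Fin (k + 1) → 𝕜) → 𝕜} (hα : 1 ≤ α) {f : (Fin (ξ + 1) → 𝕜) → 𝕜}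
    (hf : ∀ x ∈ box (Fin (M + 1)) U, g M x = f fun i => x ⟨α + i, by omega⟩) {n m : ℤ}
    (hm : m = n + M) {u : ℤ → 𝕜} (hu : u ∈ box ℤ U) :
    scalarBracket M g n m u = f fun i => u (n + α + (i : ℕ)) := by
  rw [scalarBracket, if_pos (by lia)]
  have h1 : g (m - n).toNat (fun i => u (n + (i : ℕ))) = g M fun i => u (n + (i : ℕ)) :=
    apply_congr_size (by lia) fun t _ _ => rfl
  rw [h1, hf _ fun i => hu _]
  congr 1
  ext i
  push_cast
  rw [add_assoc]

/-- The Jacobi identity for `u_0, u_M, u_c` with `c = M + α + i` expresses `∑_k ∂_k f {u_{α+k},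
u_c}` as a multiple of `f`. The terms `k < i` vanish by distance, those with `k > i` are multiples
of `f` by `htop`, and for `k = i` the bracket is the leading coefficient, a shifted copy of `f`.
Division by that copy gives the claim, once `hbot` has shown that it has no zeros. -/
theorem hasLogDeriv_of_poisson {M α ξ : ℕ} (hM : M = 2 * α + ξ) (hα : 1 ≤ α) {U : Set 𝕜}
    (hU : IsOpen U) (hUc : IsPreconnected U) {g : (k : ℕ) → (Fin (k + 1) → 𝕜) → 𝕜}
    (hg : ∀ k, 1 ≤ k → k ≤ M → AnalyticOnNhd 𝕜 (g k) (box (Fin (k + 1)) U))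
    (hP : IsPoisson (box ℤ U) (scalarBracket M g)) {f : (Fin (ξ + 1) → 𝕜) → 𝕜}
    (hfa : AnalyticOnNhd 𝕜 f (box (Fin (ξ + 1)) U))
    (hf : ∀ x ∈ box (Fin (M + 1)) U, g M x = f fun i => x ⟨α + i, by omega⟩)
    {z : Fin (ξ + 1) → 𝕜} (hz : z ∈ box (Fin (ξ + 1)) U) (hfz : f z ≠ 0) (i : Fin (ξ + 1))
    (htop : ∀ k, i < k → HasLogDeriv U f k)
    (hbot : ∀ k : Fin (ξ + 1), (k : ℕ) + i < ξ → HasLogDeriv U f k) : HasLogDeriv U f i := by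
  have hi := i.2
  set P := scalarBracket M g with hPdef
  set c : ℤ := M + α + (i : ℕ) with hc
  -- a lattice configuration in which `y` occupies the places `α, …, α + ξ`
  let u : (Fin (ξ + 1) → 𝕜) → ℤ → 𝕜 := fun y t =>
    if h : (α : ℤ) ≤ t ∧ t ≤ α + ξ then y ⟨(t - α).toNat, by lia⟩
    else if h : (2 * α + (i : ℕ) : ℤ) ≤ t ∧ t ≤ 2 * α + (i : ℕ) + ξ then
      z ⟨(t - (2 * α + (i : ℕ))).toNat, by lia⟩
    else z 0
  have hu : ∀ y ∈ box (Fin (ξ + 1)) U, u y ∈ box ℤ U := by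
    intro y hy t
    simp only [u]
    split_ifs
    exacts [hy _, hz _, hz _]
  have hua : ∀ t y, AnalyticAt 𝕜 (fun y => u y t) y := by
    intro t y
    simp only [u]
    split_ifs
    · exact (ContinuousLinearMap.proj (R := 𝕜) (φ := fun _ : Fin (ξ + 1) => 𝕜) _).analyticAt y
    · exact analyticAt_const
    · exact analyticAt_const
  have huy : ∀ y (k : Fin (ξ + 1)), u y (α + (k : ℕ)) = y k := by
    intro y k
    have hk := k.2
    simp only [u]
    rw [dif_pos (by lia)]
    congr 1
    ext
    simp
  have hufar : ∀ y y' t, (M : ℤ) ≤ t → u y t = u y' t := by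
    intro y y' t ht
    have h0 : ¬((α : ℤ) ≤ t ∧ t ≤ α + ξ) := by omega
    simp only [u, dif_neg h0]
  -- The arguments of the leading coefficient `{u_{α+i}, u_c}`.
  let zy : (Fin (ξ + 1) → 𝕜) → Fin (ξ + 1) → 𝕜 := fun y k =>
    u y (α + (i : ℕ) + α + (k : ℕ))
  -- The `k`-th argument sits at the site `2α + i + k`. It differs from `z k` only if this site
  -- belongs to `y`, which forces `k + i ≤ ξ - α < ξ`; `hbot` covers these arguments.
  have hzy : ∀ y ∈ box (Fin (ξ + 1)) U, f (zy y) ≠ 0 := by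
    intro y hy
    refine ne_zero_of_hasLogDeriv hU hUc hfa hz (fun k => hu y hy _) hfz fun k hk => ?_
    have hk2 := k.2
    refine hbot k ?_
    by_contra hcon
    refine hk ?_
    simp only [zy, u]
    rw [dif_neg (by omega), dif_pos (by omega)]
    congr 1
    ext
    simp only
    omega
  have htop' : ∀ k, ∃ B : (Fin (ξ + 1) → 𝕜) → 𝕜, i < k → AnalyticOnNhd 𝕜 B (box (Fin (ξ + 1)) U) ∧
      ∀ y ∈ box (Fin (ξ + 1)) U, partialDeriv f k y = B y * f y := by
    intro k
    by_cases hk : i < k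
    · obtain ⟨B, hB⟩ := htop k hk
      exact ⟨B, fun _ => hB⟩
    · exact ⟨0, fun h => absurd h hk⟩
  choose B hB using htop'
  let D : 𝕜 := partialDeriv (P M c) M (u z)
  -- `{u_M, u_c}` involves only the sites from `M` on, beyond the last site `α + ξ` of `y`.
  have hD : ∀ y, partialDeriv (P M c) M (u y) = D := by
    intro y
    simp only [D, partialDeriv]
    rw [hufar y z M le_rfl]
    congr 1
    ext t
    refine scalarBracket_shift M g 0 (add_zero _).symm (add_zero _).symm fun s hs _ => ?_
    rw [add_zero]
    by_cases h : s = M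
    · rw [h]; simp
    · simp only [Function.update_of_ne h]
      exact hufar y z s (by lia)
  have hlead : ∀ n m : ℤ, m = n + M → ∀ v ∈ box ℤ U, P n m v = f fun i => v (n + α + (i : ℕ)) :=
    fun n m hnm v hv => scalarBracket_leading hM hα hf hnm hv
  have hjac : ∀ y ∈ box (Fin (ξ + 1)) U,
      ∑ k, partialDeriv f k y * P (α + (k : ℕ)) c (u y) = D * f y := by
    intro y hy
    have hJ := hP.jacobi 0 M c (u y) (hu y hy)
    let e : Fin (ξ + 1) ↪ ℤ := ⟨fun k => 0 + α + (k : ℕ), fun a b hab => by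
      ext; simpa using hab⟩
    have hue : u y ∘ e = y := by
      ext k
      simp only [e, Function.comp_apply, Function.Embedding.coeFn_mk, zero_add]
      exact huy y k
    have h1 : bracketWithCoord P (P 0 M) c (u y) =
        ∑ k, partialDeriv f k y * P (α + (k : ℕ)) c (u y) := by
      rw [bracketWithCoord_congr_box hU P (F' := fun v => f (v ∘ e))
        (fun v hv => hlead 0 M (zero_add _).symm v hv) c (hu y hy), bracketWithCoord_embedding, hue]
      simp [e]
    have h2 : bracketWithCoord P (P M c) 0 (u y) = -(D * f y) := by
      rw [bracketWithCoord, finsum_eq_single _ (M : ℤ), hD]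
      · have h3 : P M 0 (u y) = -P 0 M (u y) := scalarBracket_swap M g _ _ _
        rw [h3, hlead 0 M (zero_add _).symm _ (hu y hy), mul_neg,
          show (fun i : Fin (ξ + 1) => u y (0 + α + (i : ℕ))) = y from hue]
      · intro s hs
        rcases lt_or_gt_of_ne hs with h | h
        · rw [partialDeriv_eq_zero fun t => ?_, zero_mul]
          refine scalarBracket_shift M g 0 (add_zero _).symm (add_zero _).symm fun r hr _ => ?_
          rw [add_zero, Function.update_of_ne (by lia)]
        · rw [show P s 0 (u y) = 0 from scalarBracket_far M g (by lia) _, mul_zero]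
    -- `u_c` and `u_0` are more than `M` apart, as `α ≥ 1`.
    have h3 : bracketWithCoord P (P c 0) M (u y) = 0 := by
      rw [bracketWithCoord]
      refine finsum_eq_zero_of_forall_eq_zero fun s => ?_
      rw [partialDeriv_eq_zero fun t => ?_, zero_mul]
      rw [hPdef, scalarBracket_far M g (by lia), scalarBracket_far M g (by lia)]
    rw [h1, h2, h3] at hJ
    linear_combination hJ
  refine ⟨fun y => (D - ∑ k, if i < k then B k y * P (α + (k : ℕ)) c (u y) else 0) / f (zy y),
    fun y hy => ?_, fun y hy => ?_⟩
  · refine AnalyticAt.fun_div (analyticAt_const.fun_sub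
      (Finset.analyticAt_fun_sum _ fun k _ => ?_)) ?_ (hzy y hy)
    · split_ifs with hk
      · exact ((hB k hk).1 y hy).fun_mul
          (analyticAt_scalarBracket hg (fun t => hua t y) (hu y hy) _ _)
      · exact analyticAt_const
    · exact AnalyticAt.fun_comp (hfa _ fun k => hu y hy _) (AnalyticAt.pi fun k => hua _ y)
  · have h1 := hjac y hy
    have h2 : ∀ k, partialDeriv f k y * P (α + (k : ℕ)) c (u y) =
        (if k = i then partialDeriv f i y * f (zy y) else 0) +
        (if i < k then B k y * P (α + (k : ℕ)) c (u y) else 0) * f y := by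
      intro k
      rcases lt_trichotomy k i with h | h | h
      · have h' : (k : ℕ) < i := h
        rw [if_neg h.ne, if_neg h.not_gt, hPdef, scalarBracket_far M g (by lia)]
        simp
      · subst h
        rw [if_pos rfl, if_neg (lt_irrefl _), hlead _ _ (by lia) _ (hu y hy)]
        simp [zy]
      · rw [if_neg h.ne', if_pos h, (hB k h).2 y hy]
        ring
    simp only [h2, Finset.sum_add_distrib, ← Finset.sum_mul, Finset.sum_ite_eq',
      Finset.mem_univ, if_true] at h1
    field_simp [hzy y hy]
    linear_combination h1

end DiscretePB

/-! ### Reflection of the lattice, and induction over the arguments of the leading coefficient -/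

namespace DiscretePB

variable {𝕜 : Type*} [RCLike 𝕜]

/-- The coefficients of the bracket in the reflected variables `u_{-n}`. -/
def reflect (g : (k : ℕ) → (Fin (k + 1) → 𝕜) → 𝕜) (k : ℕ) (x : Fin (k + 1) → 𝕜) : 𝕜 :=
  -g k (x ∘ Fin.revPerm.symm)

lemma scalarBracket_reflect (M : ℕ) (g : (k : ℕ) → (Fin (k + 1) → 𝕜) → 𝕜) (n m : ℤ) (u : ℤ → 𝕜) :
    scalarBracket M g (-n) (-m) (u ∘ (Equiv.neg ℤ).symm) = scalarBracket M (reflect g) n m u := by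
  have key : ∀ n m : ℤ, n < m → m ≤ n + M → scalarBracket M g (-n) (-m) (u ∘ (Equiv.neg ℤ).symm) =
      scalarBracket M (reflect g) n m u := by
    intro n m h1 h2
    rw [scalarBracket, if_neg (by lia), if_pos (by lia), scalarBracket, if_pos (by lia), reflect]
    congr 1
    refine apply_congr_size (by lia) fun t ht ht' => ?_
    simp only [Function.comp_apply, Equiv.neg_symm, Equiv.neg_apply, Fin.revPerm_symm,
      Fin.revPerm_apply, Fin.val_rev]
    congr 1
    have : t ≤ (m - n).toNat := Nat.lt_succ_iff.1 ht'
    omega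
  by_cases h1 : n < m ∧ m ≤ n + M
  · exact key n m h1.1 h1.2
  · by_cases h2 : m < n ∧ n ≤ m + M
    · rw [scalarBracket_swap M g (-m), scalarBracket_swap M (reflect g) m, key m n h2.1 h2.2]
    · rw [scalarBracket, if_neg (by lia), if_neg (by lia), scalarBracket, if_neg h1, if_neg h2]

lemma IsPoisson.reflect {M : ℕ} {g : (k : ℕ) → (Fin (k + 1) → 𝕜) → 𝕜} {U : Set 𝕜}
    (hP : IsPoisson (box ℤ U) (scalarBracket M g)) :
    IsPoisson (box ℤ U) (scalarBracket M (reflect g)) := by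
  have h1 := hP.reindex (Equiv.neg ℤ)
  simpa only [Equiv.neg_apply, scalarBracket_reflect] using h1

lemma analyticOnNhd_neg_comp_equiv {ι κ : Type*} [Fintype ι] [Fintype κ] (e : ι ≃ κ) {U : Set 𝕜}
    {F : (κ → 𝕜) → 𝕜} (hF : AnalyticOnNhd 𝕜 F (box κ U)) :
    AnalyticOnNhd 𝕜 (fun y => -F (y ∘ e.symm)) (box ι U) := fun y hy =>
  (AnalyticAt.fun_comp (g := F) (f := fun y : ι → 𝕜 => y ∘ e.symm) (hF _ fun _ => hy _)
    (AnalyticAt.pi fun _ =>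
      (ContinuousLinearMap.proj (R := 𝕜) (φ := fun _ : ι => 𝕜) _).analyticAt y)).fun_neg

lemma HasLogDeriv.neg_comp_equiv {ι κ : Type*} [Fintype ι] [Fintype κ] [DecidableEq ι]
    [DecidableEq κ] (e : ι ≃ κ) {U : Set 𝕜} {f : (κ → 𝕜) → 𝕜} {k : ι}
    (h : HasLogDeriv U f (e k)) : HasLogDeriv U (fun y => -f (y ∘ e.symm)) k := by
  obtain ⟨B, hB, hBf⟩ := h
  refine ⟨fun y => - -B (y ∘ e.symm), (analyticOnNhd_neg_comp_equiv e hB).neg, fun y hy => ?_⟩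
  rw [partialDeriv_neg, partialDeriv_comp_equiv, hBf (y ∘ e.symm) fun _ => hy _]
  ring

/-- The leading coefficient of an `(α, ξ)`-bracket has no zeros. -/
theorem IsAlphaXiBracket.leading_ne_zero {α ξ : ℕ} (hα : 1 ≤ α) {U : Set 𝕜} (hU : IsOpen U)
    (hUc : IsConnected U) {g : (k : ℕ) → (Fin (k + 1) → 𝕜) → 𝕜} (h : IsAlphaXiBracket α ξ U g) :
    ∀ x ∈ box (Fin (2 * α + ξ + 1)) U, g (2 * α + ξ) x ≠ 0 := by
  obtain ⟨f, hf, y₀, hy₀, hd⟩ := h.leading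
  obtain ⟨a, ha⟩ := hUc.nonempty
  have hfa : AnalyticOnNhd 𝕜 f (box (Fin (ξ + 1)) U) := by
    -- The remaining arguments of `g_M` are filled with a point `a` of `U`, so that `f` inherits
    -- analyticity from `g_M`.
    let E : (Fin (ξ + 1) → 𝕜) → Fin (2 * α + ξ + 1) → 𝕜 := fun y t =>
      if h : α ≤ (t : ℕ) ∧ (t : ℕ) ≤ α + ξ then y ⟨t - α, by omega⟩ else a
    have hE : ∀ y ∈ box (Fin (ξ + 1)) U, E y ∈ box (Fin (2 * α + ξ + 1)) U := fun y hy t => by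
      simp only [E]
      split_ifs
      exacts [hy _, ha]
    have hEa : ∀ y, AnalyticAt 𝕜 E y := fun y => AnalyticAt.pi fun t => by
      split_ifs
      · exact (ContinuousLinearMap.proj (R := 𝕜) (φ := fun _ : Fin (ξ + 1) => 𝕜) _).analyticAt y
      · exact analyticAt_const
    have hfE : ∀ y ∈ box (Fin (ξ + 1)) U, g (2 * α + ξ) (E y) = f y := fun y hy => by
      rw [hf _ (hE y hy)]
      congr 1
      ext i
      have hi := i.2
      simp only [E]
      rw [dif_pos (by omega)]
      congr 1
      ext
      simp
    exact AnalyticOnNhd.congr (isOpen_box hU) (fun y hy => AnalyticAt.fun_comp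
      (h.analytic _ (by omega) le_rfl _ (hE y hy)) (hEa y)) hfE
  obtain ⟨z, hz, hfz⟩ : ∃ z ∈ box (Fin (ξ + 1)) U, f z ≠ 0 := by
    by_contra! hcon
    refine hd ?_
    rw [partialDeriv_congr_box hU (F' := fun _ => 0) hcon 0 hy₀,
      partialDeriv_eq_zero fun _ => rfl, zero_mul]
  -- The leading coefficient of the reflected bracket; the sign appears because reflection exchanges
  -- the two entries.
  let f' : (Fin (ξ + 1) → 𝕜) → 𝕜 := fun y => -f (y ∘ Fin.revPerm.symm)
  have hf' : ∀ x ∈ box (Fin (2 * α + ξ + 1)) U,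
      reflect g (2 * α + ξ) x = f' fun i => x ⟨α + i, by omega⟩ := by
    intro x hx
    rw [reflect, hf (x ∘ Fin.revPerm.symm) fun _ => hx _]
    simp only [f']
    congr 2
    ext i
    have hi := i.2
    simp only [Function.comp_apply, Fin.revPerm_symm, Fin.revPerm_apply, Fin.rev]
    congr 2
    omega
  have hga' : ∀ k, 1 ≤ k → k ≤ 2 * α + ξ →
      AnalyticOnNhd 𝕜 (reflect g k) (box (Fin (k + 1)) U) := fun k h1 h2 =>
    analyticOnNhd_neg_comp_equiv Fin.revPerm (h.analytic k h1 h2)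
  have hto : ∀ k : Fin (ξ + 1), HasLogDeriv U f k.rev → HasLogDeriv U f' k := fun k hk =>
    hk.neg_comp_equiv (e := Fin.revPerm)
  have hfrom : ∀ k : Fin (ξ + 1), HasLogDeriv U f' k.rev → HasLogDeriv U f k := fun k hk => by
    have h1 := hk.neg_comp_equiv (e := Fin.revPerm)
    have h2 : (fun y => -f' (y ∘ Fin.revPerm.symm)) = f := by
      ext y
      simp only [f', neg_neg]
      congr 1
      ext i
      simp
    rwa [h2] at h1
  -- Induction from both ends: once the `j` outermost arguments on each side are settled, the
  -- bracket settles `ξ - j` and its reflection settles `j`. Both are needed, as `hbot` for the next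
  -- index uses the low arguments.
  have key : ∀ j : ℕ, j ≤ ξ + 1 → ∀ k : Fin (ξ + 1), ((k : ℕ) < j ∨ ξ < k + j) →
      HasLogDeriv U f k := by
    intro j
    induction j with
    | zero => intro _ k hk; omega
    | succ j ih =>
      intro hj
      have ih' := ih (by omega)
      let i : Fin (ξ + 1) := ⟨ξ - j, by omega⟩
      have htop : HasLogDeriv U f i :=
        hasLogDeriv_of_poisson rfl hα hU hUc.isPreconnected h.analytic h.poisson hfa hf hz hfz i
          (fun k hk => ih' k (by have : ξ - j < k := hk; omega))
          (fun k hk => ih' k (by simp only [i] at hk; omega))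
      have hbot : HasLogDeriv U f' i :=
        hasLogDeriv_of_poisson rfl hα hU hUc.isPreconnected hga' h.poisson.reflect
          (analyticOnNhd_neg_comp_equiv Fin.revPerm hfa) hf' (z := z ∘ Fin.rev) (fun _ => hz _)
          (by
            have h1 : (z ∘ Fin.rev) ∘ (Fin.revPerm.symm : Fin (ξ + 1) → Fin (ξ + 1)) = z := by
              ext k; simp
            simpa only [f', h1, neg_ne_zero] using hfz) i
          (fun k hk => hto k (ih' _ (by
            have : ξ - j < k := hk
            simp only [Fin.rev]; omega)))
          (fun k hk => hto k (ih' _ (by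
            simp only [i] at hk
            simp only [Fin.rev]; omega)))
      intro k hk
      by_cases hk' : (k : ℕ) < j ∨ ξ < k + j
      · exact ih' k hk'
      · rcases (by omega : (k : ℕ) = j ∨ k + j = ξ) with h1 | h1
        · refine hfrom k ?_
          have h2 : k.rev = i := by ext; simp only [Fin.rev, i]; omega
          rwa [h2]
        · have h2 : k = i := by ext; simp only [i]; omega
          rwa [h2]
  intro x hx
  rw [hf x hx]
  exact ne_zero_of_hasLogDeriv hU hUc.isPreconnected hfa hz (fun _ => hx _) hfz
    fun k _ => key (ξ + 1) le_rfl k (Or.inl k.2)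

end DiscretePB

namespace DiscretePB

variable {𝕜 : Type*} [RCLike 𝕜]

open VectorField Matrix

/-! ### The matrices of a bracket with parameters -/


lemma lamEdge_zero {α ξ : ℕ} (hα : 1 ≤ α) (τ : Fin (ξ + 1) → 𝕜) : lamEdge α τ 0 = 1 := by
  rw [lamEdge, if_pos (by omega), det_fin_zero]

lemma analyticAt_exp_comp {E : Type*} [NormedAddCommGroup E] [NormedSpace 𝕜 E] {φ : E → 𝕜} {v : E}
    (hφ : AnalyticAt 𝕜 φ v) : AnalyticAt 𝕜 (fun v => NormedSpace.exp (φ v)) v :=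
  AnalyticAt.fun_comp (g := NormedSpace.exp) (NormedSpace.exp_analytic _) hφ

lemma analyticAt_proj {ι : Type*} [Fintype ι] (i : ι) (v : ι → 𝕜) :
    AnalyticAt 𝕜 (fun v : ι → 𝕜 => v i) v :=
  (ContinuousLinearMap.proj (R := 𝕜) (φ := fun _ : ι => 𝕜) i).analyticAt v

lemma analyticAt_matL (α : ℕ) {ξ : ℕ} (τ : Fin (ξ + 1) → 𝕜) (i s : Fin (2 * α + ξ))
    (v : Fin (2 * α + ξ) → 𝕜) : AnalyticAt 𝕜 (fun v => matL α τ v i s) v := by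
  unfold matL
  refine analyticAt_const.fun_mul (analyticAt_exp_comp (Finset.analyticAt_fun_sum _ fun k _ => ?_))
  split_ifs
  · exact analyticAt_const.fun_mul (analyticAt_proj _ v)
  · exact analyticAt_const

lemma analyticAt_matR (α : ℕ) {ξ : ℕ} (τ : Fin (ξ + 1) → 𝕜) (s j : Fin (2 * α + ξ))
    (w : Fin (2 * α + ξ) → 𝕜) : AnalyticAt 𝕜 (fun w => matR α τ w s j) w := by
  unfold matR
  refine AnalyticAt.fun_mul (analyticAt_exp_comp (Finset.analyticAt_fun_sum _ fun k _ => ?_))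
    analyticAt_const
  split_ifs
  · exact analyticAt_const.fun_mul (analyticAt_proj _ w)
  · exact analyticAt_const

/-- The exponent splits into the sites in the first cell and those in the second. The constants
multiply to `λ^s_{s-r}` because `λ^α_α = 1`. -/
lemma matL_mul_matR_term {α ξ : ℕ} (hα : 1 ≤ α) (τ : Fin (ξ + 1) → 𝕜)
    (v w : Fin (2 * α + ξ) → 𝕜) (i j q : Fin (2 * α + ξ)) :
    matL α τ v i q * matR α τ w q j =
      if ((q : ℕ) ≤ i ∧ (i : ℕ) ≤ q + α) ∧ (j : ℕ) ≤ q ∧ (q : ℕ) ≤ j + α then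
        lam α τ (α - (i - q)) (q - j) *
          NormedSpace.exp (∑ k : Fin (ξ + 1), τ k * pairCoord v w (α + q + k))
      else 0 := by
  have hexp : (∑ k : Fin (ξ + 1), τ k * pairCoord v w (α + q + k)) =
      (∑ k : Fin (ξ + 1),
        if h : α + (q : ℕ) + k < 2 * α + ξ then τ k * v ⟨α + q + k, h⟩ else 0) +
      ∑ k : Fin (ξ + 1),
        if h : α + ξ ≤ (q : ℕ) + k then
          τ k * w ⟨(q : ℕ) + k - (α + ξ), by have := q.2; have := k.2; omega⟩ else 0 := by
    rw [← Finset.sum_add_distrib]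
    refine Finset.sum_congr rfl fun k _ => ?_
    have hq := q.2
    have hk := k.2
    rw [pairCoord]
    by_cases h : α + (q : ℕ) + k < 2 * α + ξ
    · rw [dif_pos h, dif_pos h, dif_neg (by omega), add_zero]
    · rw [dif_neg h, dif_neg h, dif_pos (by omega), dif_pos (by omega), zero_add]
      congr 3
      omega
  rw [hexp, NormedSpace.exp_add]
  unfold matL matR
  by_cases h1 : (q : ℕ) ≤ i ∧ (i : ℕ) ≤ q + α
  · by_cases h2 : (j : ℕ) ≤ q ∧ (q : ℕ) ≤ j + α
    · rw [if_pos h1, if_pos h2, if_pos ⟨h1, h2⟩, lam, lam, lamEdge_zero hα]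
      ring
    · simp only [h2, and_false, if_false, mul_zero]
  · simp only [h1, false_and, if_false, zero_mul]

theorem HasParameters.cellNext_eq_mul {α ξ : ℕ} [NeZero (2 * α + ξ)] (hα : 1 ≤ α)
    {τ : Fin (ξ + 1) → 𝕜} {U : Set 𝕜} {g : (k : ℕ) → (Fin (k + 1) → 𝕜) → 𝕜}
    (h : HasParameters α τ U g) {v w : Fin (2 * α + ξ) → 𝕜} (hv : v ∈ box _ U)
    (hw : w ∈ box _ U) : cellNext (2 * α + ξ) g v w = matL α τ v * matR α τ w := by
  ext i j
  have hi := i.2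
  have hj := j.2
  rw [mul_apply]
  simp only [matL_mul_matR_term hα]
  rcases lt_or_ge i j with hij | hij
  · rw [cellNext_apply_of_lt v w hij]
    have hij' : (i : ℕ) < j := hij
    exact (Finset.sum_eq_zero fun q _ => if_neg (by omega)).symm
  · have hij' : (j : ℕ) ≤ i := hij
    rw [cellNext_apply_of_le v w hij, h _ (by omega) (by omega) _ fun t =>
      pairCoord_mem hv hw (by omega)]
    simp only [dite_eq_ite]
    rw [← Finset.sum_product', ← Finset.sum_filter, ← Finset.sum_filter]
    -- The pair `(s, r)` corresponds to the intermediate index `q = j + r`; the constraint on `(s,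
    -- r)` then reads `s = α - (i - q)`.
    refine Finset.sum_bij' (fun p hp => ⟨j + p.2, ?_⟩)
      (fun q hq => (⟨α - (i - q), by omega⟩, ⟨q - j, ?_⟩)) ?_ ?_ ?_ ?_ ?_
    · have h1 := (Finset.mem_filter.1 hp).2
      have := p.1.2
      omega
    · have h1 := (Finset.mem_filter.1 hq).2
      omega
    · intro p hp
      have h1 := (Finset.mem_filter.1 hp).2
      have := p.1.2
      have := p.2.2
      simp only [Finset.mem_filter, Finset.mem_univ, true_and]
      omega
    · intro q hq
      have h1 := (Finset.mem_filter.1 hq).2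
      simp only [Finset.mem_filter, Finset.mem_product, Finset.mem_univ, true_and]
      omega
    · intro p hp
      have h1 := (Finset.mem_filter.1 hp).2
      have := p.1.2
      have := p.2.2
      ext
      · simp only; omega
      · simp only; omega
    · intro q hq
      have h1 := (Finset.mem_filter.1 hq).2
      ext
      simp only
      omega
    · intro p hp
      have h1 := (Finset.mem_filter.1 hp).2
      have h2 := p.1.2
      have h3 := p.2.2
      simp only
      rw [show α - ((i : ℕ) - (j + p.2)) = p.1 by omega, show (j : ℕ) + p.2 - j = p.2 by omega]
      congr 2
      refine Finset.sum_congr rfl fun k _ => ?_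
      rw [show (i : ℕ) + (p.1 + k) = α + (j + p.2) + k by omega]

/-! ### The structure constants of a family of vector fields -/

open Classical in
/-- The structure constants of a family of vector fields which span a Lie algebra, and `0` for
other families. -/
noncomputable def structureConstants {N : ℕ} (X : Fin N → (Fin N → 𝕜) → (Fin N → 𝕜)) :
    Fin N → Fin N → Fin N → 𝕜 :=
  if h : ∃ c : Fin N → Fin N → Fin N → 𝕜, ∀ p q v,
    lieBracket 𝕜 (X p) (X q) v = ∑ r, c p q r • X r v then h.choose else 0

/-- The commutation relations extend from `W` to the whole space by the identity theorem, and
independence at one point makes the constants unique. Thus constants found on any `W` agree with a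
choice that does not refer to `W`. -/
theorem structureConstants_eq {N : ℕ} {X : Fin N → (Fin N → 𝕜) → (Fin N → 𝕜)}
    (hX : ∀ p, AnalyticOnNhd 𝕜 (X p) Set.univ) {W : Set (Fin N → 𝕜)} (hW : IsOpen W)
    {v₀ : Fin N → 𝕜} (hv₀ : v₀ ∈ W) (hdet : (frameMatrix X v₀).det ≠ 0)
    {c : Fin N → Fin N → Fin N → 𝕜}
    (hc : ∀ p q, ∀ v ∈ W, lieBracket 𝕜 (X p) (X q) v = ∑ r, c p q r • X r v) :
    structureConstants X = c := by
  have hglob : ∀ p q v, lieBracket 𝕜 (X p) (X q) v = ∑ r, c p q r • X r v := fun p q v =>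
    (analyticOnNhd_lieBracket (hX p) (hX q)).eqOn_of_preconnected_of_eventuallyEq
      (fun v hv => Finset.analyticAt_fun_sum _ fun r _ => analyticAt_const.fun_smul (hX r v hv))
      isPreconnected_univ (Set.mem_univ v₀)
      (Filter.eventually_of_mem (hW.mem_nhds hv₀) (hc p q)) (Set.mem_univ v)
  have hex : ∃ c : Fin N → Fin N → Fin N → 𝕜, ∀ p q v,
    lieBracket 𝕜 (X p) (X q) v = ∑ r, c p q r • X r v := ⟨c, hglob⟩
  rw [structureConstants, dif_pos hex]
  have hli := linearIndependent_of_frameMatrix hdet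
  funext p q r
  have h1 : ∑ r, (hex.choose p q r - c p q r) • X r v₀ = 0 := by
    simp only [sub_smul, Finset.sum_sub_distrib]
    rw [← hex.choose_spec p q v₀, ← hglob p q v₀, sub_self]
  exact sub_eq_zero.1 (Fintype.linearIndependent_iff.1 hli _ h1 r)

end DiscretePB

/-! ### The main theorem -/

theorem mainTheorem6 {𝕜 : Type*} [RCLike 𝕜] (α ξ : ℕ) (hα : 1 ≤ α) :
    ∃ c γ : (Fin (ξ + 1) → 𝕜) →
        Fin (2 * α + ξ) → Fin (2 * α + ξ) → Fin (2 * α + ξ) → 𝕜,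
      ∀ (U : Set 𝕜), IsOpen U → IsConnected U →
      ∀ g : (k : ℕ) → (Fin (k + 1) → 𝕜) → 𝕜, DiscretePB.IsAlphaXiBracket α ξ U g →
      ∃ (h : (Fin (2 * α + ξ) → 𝕜) → Matrix (Fin (2 * α + ξ)) (Fin (2 * α + ξ)) 𝕜)
        (G : (Fin (2 * α + ξ) → 𝕜) → (Fin (2 * α + ξ) → 𝕜) →
          Matrix (Fin (2 * α + ξ)) (Fin (2 * α + ξ)) 𝕜),
        -- the consolidated bracket is the first-order bracket with coefficients `h`, `G`
        (∀ u ∈ DiscretePB.box ℤ U, ∀ (n m : ℤ) (i j : Fin (2 * α + ξ)),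
          DiscretePB.firstOrderBracket h G (n, i) (m, j)
              (DiscretePB.consolidate (2 * α + ξ) u) =
            DiscretePB.scalarBracket (2 * α + ξ) g
              (n * (2 * α + ξ : ℕ) + (i : ℕ)) (m * (2 * α + ξ : ℕ) + (j : ℕ)) u) ∧
        (∀ i j, AnalyticOnNhd 𝕜 (fun v => h v i j) (DiscretePB.box (Fin (2 * α + ξ)) U)) ∧
        (∀ i j, AnalyticOnNhd 𝕜
          (fun x : (Fin (2 * α + ξ) → 𝕜) × (Fin (2 * α + ξ) → 𝕜) => G x.1 x.2 i j)
          (DiscretePB.box (Fin (2 * α + ξ)) U ×ˢ DiscretePB.box (Fin (2 * α + ξ)) U)) ∧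
        -- it is a Poisson bracket, and it is non-degenerate
        DiscretePB.IsPoisson (DiscretePB.box (ℤ × Fin (2 * α + ξ)) U)
          (DiscretePB.firstOrderBracket h G) ∧
        (∀ v ∈ DiscretePB.box (Fin (2 * α + ξ)) U, ∀ w ∈ DiscretePB.box (Fin (2 * α + ξ)) U,
          (G v w).det ≠ 0) ∧
        -- it factorizes, with an associated Lie bialgebra
        (∃ (L R : (Fin (2 * α + ξ) → 𝕜) → Matrix (Fin (2 * α + ξ)) (Fin (2 * α + ξ)) 𝕜)
          (c' γ' : Fin (2 * α + ξ) → Fin (2 * α + ξ) → Fin (2 * α + ξ) → 𝕜),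
          DiscretePB.HasLieBialgebra (DiscretePB.box (Fin (2 * α + ξ)) U) h G L R c' γ') ∧
        -- for a bracket with parameters `τ`, the matrices and the constants depend only on `τ`
        (∀ τ : Fin (ξ + 1) → 𝕜, DiscretePB.HasParameters α τ U g →
          DiscretePB.HasLieBialgebra (DiscretePB.box (Fin (2 * α + ξ)) U) h G
            (DiscretePB.matL α τ) (DiscretePB.matR α τ) (c τ) (γ τ)) := by
  have : NeZero (2 * α + ξ) := ⟨by omega⟩
  -- These constants are defined from `τ` before `U` and the bracket are given; the value `0` is
  -- taken where no relations hold.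
  refine ⟨fun τ => DiscretePB.structureConstants fun s v i => DiscretePB.matL α τ v i s,
    fun τ => DiscretePB.structureConstants fun s v j => DiscretePB.matR α τ v s j,
    fun U hU hUc g hg => ?_⟩
  have hW := DiscretePB.isOpen_box (ι := Fin (2 * α + ξ)) hU
  have hWc := DiscretePB.isConnected_box (ι := Fin (2 * α + ξ)) hUc
  have hP := hg.poisson.consolidated
  have hh := DiscretePB.analyticOnNhd_cellSame hg.analytic
  have hG := DiscretePB.analyticOnNhd_cellNext hg.analytic
  have hJ := hP.firstOrderJacobi hh hG
  have hdet : ∀ v ∈ DiscretePB.box (Fin (2 * α + ξ)) U, ∀ w ∈ DiscretePB.box (Fin (2 * α + ξ)) U,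
      (DiscretePB.cellNext (2 * α + ξ) g v w).det ≠ 0 := fun v hv w hw =>
    DiscretePB.det_cellNext_ne_zero (hg.leading_ne_zero hα hU hUc) hv hw
  refine ⟨DiscretePB.cellSame (2 * α + ξ) g, DiscretePB.cellNext (2 * α + ξ) g,
    fun u _ n m i j => ?_, hh, hG, hP, hdet, ?_, fun τ hτ => ?_⟩
  · rw [DiscretePB.firstOrderBracket_cell]
    congr 1
    exact DiscretePB.unconsolidate_consolidate (2 * α + ξ) u
  · obtain ⟨L, R, hL, hR, hfac⟩ := hJ.exists_factor hW hWc hdet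
    obtain ⟨c, γ, hcγ⟩ := hJ.hasLieBialgebra hW hWc hdet hh hL hR hfac
    exact ⟨L, R, c, γ, hcγ⟩
  · have hfac := fun v hv w hw => hτ.cellNext_eq_mul hα (v := v) (w := w) hv hw
    obtain ⟨c, γ, hcγ⟩ := hJ.hasLieBialgebra hW hWc hdet hh
      (fun i j v _ => DiscretePB.analyticAt_matL α τ i j v)
      (fun i j v _ => DiscretePB.analyticAt_matR α τ i j v) hfac
    obtain ⟨v₀, hv₀⟩ := hWc.nonempty
    have hdet₀ := hdet v₀ hv₀ v₀ hv₀
    rw [hfac v₀ hv₀ v₀ hv₀, Matrix.det_mul] at hdet₀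
    have hc := DiscretePB.structureConstants_eq (X := fun s v i => DiscretePB.matL α τ v i s)
      (fun p v _ => AnalyticAt.pi fun i => DiscretePB.analyticAt_matL α τ i p v) hW hv₀
      (left_ne_zero_of_mul hdet₀) hcγ.columns.bracket
    have hγ := DiscretePB.structureConstants_eq (X := fun s v j => DiscretePB.matR α τ v s j)
      (fun p v _ => AnalyticAt.pi fun j => DiscretePB.analyticAt_matR α τ p j v) hW hv₀
      (by
        rw [← Matrix.det_transpose]
        exact right_ne_zero_of_mul hdet₀) hcγ.rows.bracket
    beta_reduce
    rw [hc, hγ]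
    exact hcγ
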